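/- **Setting.** Fix integers $n_p,n_{in}\ge 1$, a time horizon $T>0$ and a set $\mathbb P\subseteq[-1,1]^{n_p}$. A continuous-time LPV-SSA system with scalar output is a tuple of real matrices $\Sigma=(A_i,B_i,C_i)_{i=0}^{n_p}$, $A_i\in\mathbb R^{n_x\times n_x}$, $B_i\in\mathbb R^{n_x\times n_{in}}$, $C_i\in\mathbb R^{1\times n_x}$, $n_x\ge1$. Write $A(q)=A_0+\sum_{i=1}^{n_p}q_iA_i$, and similarly $B(q)$, $C(q)$. For piecewise continuous $u:[0,T]\to\mathbb R^{n_{in}}$ and $p:[0,T]\to\mathbb P$, its output is $y_\Sigma(u,p)(t)=C(p(t))x(t)$, where $x$ is the absolutely continuous solution of $\dot x(t)=A(p(t))x(t)+B(p(t))u(t)$ (for almost every $t\in[0,T]$), $x(0)=0$. For $\lambda\ge 0$, $i_q,i_r\in\{0,\dots,n_p\}$, $k\ge 0$ and $I=(i_1,\dots,i_k)\in\{1,\dots,n_p\}^k$ let $$w^\lambda_{i_q,i_r,I}(\tau)=C_{i_q}e^{A_0(\tau_{k+1}-\tau_k)}A_{i_k}e^{A_0(\tau_k-\tau_{k-1})}\cdots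 A_{i_1}e^{A_0\tau_1}B_{i_r}\,e^{\frac{\lambda}{2}\tau_{k+1}}$$ (for $k=0$: $C_{i_q}e^{A_0\tau_1}B_{i_r}e^{\frac\lambda2\tau_1}$) on $\Delta_{k+1}^\infty=\{\tau_{k+1}\ge\dots\ge\tau_1\ge0\}$, and let the $\lambda$-weighted $H_2$ norm be $$\|\Sigma\|_{\lambda,H_2}^2=\sum_{i_q,i_r=0}^{n_p}\sum_{k=0}^\infty\sum_{I\in\{1,\dots,n_p\}^k}\int_{\Delta_{k+1}^\infty}\|w^\lambda_{i_q,i_r,I}(\tau)\|_2^2\,d\tau\in[0,\infty].$$ Let $\mathcal U,\mathcal P,\mathcal Y$ be sets of piecewise continuous functions on $[0,T]$ with values in $\mathbb R^{n_{in}}$, $\mathbb P$ and $\mathbb R$, let $\mathcal E$ be a set of LPV-SSA systems (with these $n_p,n_{in}$), and let $\ell:\mathbb R\times\mathbb R\to[0,\infty)$ be a loss function. Let $\mathcal D$ be a probability measure on $\mathcal U\times\mathcal P\times\mathcal Y$, equipped with a $\sigma$-algebra for which $(u,p,y)\mapsto\ell(y_\Sigma(u,p)(T),y(T))$ is measurable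 for every $\Sigma\in\mathcal E$. The true risk and, for a data set $S=(u_i,p_i,y_i)_{i=1}^N$, the empirical risk are $$\mathcal L(\Sigma)=\mathbb E_{(u,p,y)\sim\mathcal D}[\ell(y_\Sigma(u,p)(T),y(T))],\qquad \mathcal L_N^S(\Sigma)=\frac1N\sum_{i=1}^N\ell(y_\Sigma(u_i,p_i)(T),y_i(T)).$$ **Assumptions.** 1. (Stability) $\lambda\ge n_p$, and for every $\Sigma\in\mathcal E$ there is $Q\succ0$ with $$A_0^TQ+QA_0+\sum_{i=1}^{n_p}A_i^TQA_i+\sum_{i=0}^{n_p}C_i^TC_i\prec-\lambda Q.$$ 2. (Bounded $H_2$ norm) $\|\Sigma\|_{\lambda,H_2}\le c_{\mathcal E}$ for every $\Sigma\in\mathcal E$, for the same $\lambda$, where $c_{\mathcal E}\in[0,\infty)$. 3. (Bounded signals) $\|u\|_{L^2([0,T],\mathbb R^{n_{in}})}=\big(\int_0^T\|u(t)\|_2^2dt\big)^{1/2}\le L_u$ for all $u\in\mathcal U$, and $|y(T)|\le c_y$ for all $y\in\mathcal Y$. 4. (Lipschitz loss) $|\ell(y_1,y_1')-\ell(y_2,y_2')|\le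 K_\ell(|y_1-y_2|+|y_1'-y_2'|)$ for all real $y_1,y_1',y_2,y_2'$, and $\ell(y,y)=0$ for all real $y$. **Theorem.** Let $c=2K_\ell\max\{L_u(n_p+1)c_{\mathcal E},c_y\}$ and $R(\delta)=c\,\big(2+4\sqrt{2\log(4/\delta)}\big)$. Then all the risks $\mathcal L(\Sigma)$, $\Sigma\in\mathcal E$, are expectations of integrable functions, and for every $N\ge1$ and $\delta\in(0,1)$ the event below is measurable and $$\mathbb P_{S\sim\mathcal D^N}\Big(\forall\,\Sigma\in\mathcal E:\ \mathcal L(\Sigma)-\mathcal L_N^S(\Sigma)\le\frac{R(\delta)}{\sqrt N}\Big)\ge1-\delta .$$ In particular the bound does not depend on $T$. -/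

import Mathlib

open MeasureTheory Set Filter Topology
open scoped NNReal ENNReal Matrix

noncomputable section

/-- `f` is piecewise continuous on `[a, b]`: it is continuous (relative to `[a, b]`) outside a
finite set, and all one-sided limits within `[a, b]` exist. -/
def PiecewiseContinuousOn {X : Type*} [TopologicalSpace X] (f : ℝ → X) (a b : ℝ) : Prop :=
  (∃ F : Finset ℝ, ∀ t ∈ Icc a b, t ∉ F → ContinuousWithinAt f (Icc a b) t) ∧
  (∀ t ∈ Ico a b, ∃ l, Tendsto f (𝓝[>] t) (𝓝 l)) ∧
  (∀ t ∈ Ioc a b, ∃ l, Tendsto f (𝓝[<] t) (𝓝 l))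

/-- A continuous-time LPV state-space representation with affine parameter dependence, with
`np` scheduling variables, `nin` inputs and one output, identified with the tuple of its
matrices `A_i, B_i, C_i`, `i = 0, …, np`. The state dimension is part of the system. -/
structure LPVSystem (np nin : ℕ) where
  nx : ℕ
  nx_pos : 0 < nx
  A : Fin (np + 1) → Matrix (Fin nx) (Fin nx) ℝ
  B : Fin (np + 1) → Matrix (Fin nx) (Fin nin) ℝ
  C : Fin (np + 1) → Matrix (Fin 1) (Fin nx) ℝ

/-- The affine matrix function `M(q) = M_0 + ∑_{i=1}^{np} q_i M_i`. -/
def affineMatrix {np a b : ℕ} (M : Fin (np + 1) → Matrix (Fin a) (Fin b) ℝ) (q : Fin np → ℝ) :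
    Matrix (Fin a) (Fin b) ℝ :=
  M 0 + ∑ i : Fin np, q i • M i.succ

namespace LPVSystem

variable {np nin : ℕ}

/-- `x` is a state trajectory on `[0, T]` of the system with input `u` and scheduling signal `p`:
`x` is absolutely continuous, `x(0) = 0` and `x'(t) = A(p(t)) x(t) + B(p(t)) u(t)` for almost
every `t ∈ [0, T]`. -/
structure IsStateTrajectory (G : LPVSystem np nin) (T : ℝ) (u : ℝ → Fin nin → ℝ)
    (p : ℝ → Fin np → ℝ) (x : ℝ → Fin G.nx → ℝ) : Prop where
  absCont : AbsolutelyContinuousOnInterval x 0 T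
  init : x 0 = 0
  ode : ∀ᵐ t ∂(volume.restrict (Icc 0 T)),
    HasDerivAt x (affineMatrix G.A (p t) *ᵥ x t + affineMatrix G.B (p t) *ᵥ u t) t

open Classical in
/-- The output `y_G(u, p)(t) = C(p(t)) x(t)` for `t ∈ [0, T]`, where `x` is the state trajectory
on `[0, T]` (for piecewise continuous `u`, `p` it exists and is unique on `[0, T]`). -/
def output (G : LPVSystem np nin) (T : ℝ) (u : ℝ → Fin nin → ℝ) (p : ℝ → Fin np → ℝ) (t : ℝ) : ℝ :=
  if h : ∃ x, G.IsStateTrajectory T u p x then (affineMatrix G.C (p t) *ᵥ h.choose t) 0 else 0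

/-- The product
`e^{A_0 (τ_{k+1} - τ_k)} A_{i_k} e^{A_0 (τ_k - τ_{k-1})} ⋯ A_{i_1} e^{A_0 τ_1} B_{i_r}`
for `I = (i_1, …, i_k) ∈ {1, …, np}^k`. Here `τ j` stands for `τ_{j+1}` and `I j` for `i_{j+1}`;
as an element of `Fin np`, the value `m` represents the index `m + 1`, that is `m.succ`. -/
def inputKernel (G : LPVSystem np nin) (ir : Fin (np + 1)) :
    (k : ℕ) → (Fin k → Fin np) → (Fin (k + 1) → ℝ) → Matrix (Fin G.nx) (Fin nin) ℝ
  | 0, _, τ => NormedSpace.exp (τ 0 • G.A 0) * G.B ir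
  | k + 1, I, τ =>
      NormedSpace.exp ((τ (Fin.last (k + 1)) - τ (Fin.last k).castSucc) • G.A 0) *
        G.A (I (Fin.last k)).succ *
        inputKernel G ir k (Fin.init I) (Fin.init τ)

/-- The `lam`-weighted LPV Volterra kernel `w^λ_{i_q, i_r, I}`, a row vector:
`C_{i_q}` times the product above times `e^{λ τ_{k+1} / 2}`. -/
def volterraKernel (G : LPVSystem np nin) (lam : ℝ) (iq ir : Fin (np + 1)) {k : ℕ}
    (I : Fin k → Fin np) (τ : Fin (k + 1) → ℝ) : Matrix (Fin 1) (Fin nin) ℝ :=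
  Real.exp (lam / 2 * τ (Fin.last k)) • (G.C iq * G.inputKernel ir k I τ)

end LPVSystem

/-- The unbounded simplex `{(τ_k, …, τ_1) | τ_k ≥ ⋯ ≥ τ_1 ≥ 0}` (`τ j` stands for `τ_{j+1}`). -/
def timeSimplex (k : ℕ) : Set (Fin k → ℝ) :=
  {τ | Monotone τ ∧ ∀ j, 0 ≤ τ j}

namespace LPVSystem

variable {np nin : ℕ}

/-- The square of the `lam`-weighted `H_2` norm, as an extended nonnegative real:
`∑_{i_q, i_r} ∑_k ∑_{I} ∫_{Δ_{k+1}^∞} ‖w^λ_{i_q, i_r, I}(τ)‖_2^2 dτ`. -/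
def h2NormSq (G : LPVSystem np nin) (lam : ℝ) : ℝ≥0∞ :=
  ∑ iq : Fin (np + 1), ∑ ir : Fin (np + 1), ∑' k : ℕ, ∑ I : Fin k → Fin np,
    ∫⁻ τ in timeSimplex (k + 1),
      ENNReal.ofReal (∑ j : Fin nin, (G.volterraKernel lam iq ir I τ 0 j) ^ 2)

/-- The `lam`-weighted `H_2` norm, as an extended nonnegative real. -/
def h2Norm (G : LPVSystem np nin) (lam : ℝ) : ℝ≥0∞ :=
  (G.h2NormSq lam) ^ (1 / 2 : ℝ)

/-- The quadratic stability condition with rate `lam`: for some positive definite `Q`,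
`A_0ᵀ Q + Q A_0 + ∑_{i=1}^{np} A_iᵀ Q A_i + ∑_{i=0}^{np} C_iᵀ C_i ≺ -λ Q`. -/
def IsQuadraticallyStable (G : LPVSystem np nin) (lam : ℝ) : Prop :=
  ∃ Q : Matrix (Fin G.nx) (Fin G.nx) ℝ, Q.PosDef ∧
    (-(lam • Q) - ((G.A 0)ᵀ * Q + Q * G.A 0 + ∑ i : Fin np, (G.A i.succ)ᵀ * Q * G.A i.succ
      + ∑ i : Fin (np + 1), (G.C i)ᵀ * G.C i)).PosDef

end LPVSystem

/-- The norm of `u` in `L²([0, T], ℝ^nin)`, with the Euclidean norm on `ℝ^nin`. -/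
def l2Norm {nin : ℕ} (T : ℝ) (u : ℝ → Fin nin → ℝ) : ℝ :=
  √(∫ t in (0 : ℝ)..T, ∑ j : Fin nin, (u t j) ^ 2)

/-- The sample space `𝒰 × 𝒮 × 𝒴` of triples (input, scheduling signal, label signal). It is
declared as a type of its own, so that it carries no default `σ`-algebra. -/
structure DataPoint {np nin : ℕ} (𝒰 : Set (ℝ → Fin nin → ℝ)) (𝒮 : Set (ℝ → Fin np → ℝ))
    (𝒴 : Set (ℝ → ℝ)) where
  u : 𝒰
  p : 𝒮
  y : 𝒴

section Risk

variable {np nin : ℕ} {𝒰 : Set (ℝ → Fin nin → ℝ)} {𝒮 : Set (ℝ → Fin np → ℝ)} {𝒴 : Set (ℝ → ℝ)}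

/-- The loss `ℓ(y_G(u, p)(T), y(T))` of the system `G` at the data point `(u, p, y)`. -/
def pointLoss (loss : ℝ → ℝ → ℝ) (T : ℝ) (G : LPVSystem np nin) (z : DataPoint 𝒰 𝒮 𝒴) : ℝ :=
  loss (G.output T z.u z.p T) ((z.y : ℝ → ℝ) T)

/-- The true risk at time `T`. -/
def trueRisk [MeasurableSpace (DataPoint 𝒰 𝒮 𝒴)] (D : Measure (DataPoint 𝒰 𝒮 𝒴))
    (loss : ℝ → ℝ → ℝ) (T : ℝ) (G : LPVSystem np nin) : ℝ :=
  ∫ z, pointLoss loss T G z ∂D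

/-- The empirical risk at time `T` with respect to the data set `S`. -/
def empiricalRisk {N : ℕ} (S : Fin N → DataPoint 𝒰 𝒮 𝒴)
    (loss : ℝ → ℝ → ℝ) (T : ℝ) (G : LPVSystem np nin) : ℝ :=
  1 / (N : ℝ) * ∑ i : Fin N, pointLoss loss T G (S i)

/-- The set of data sets of size `N` for which `ℒ(G) - ℒ_N^S(G) ≤ r` for all `G ∈ E`. -/
def uniformGapEvent [MeasurableSpace (DataPoint 𝒰 𝒮 𝒴)] (D : Measure (DataPoint 𝒰 𝒮 𝒴))
    (loss : ℝ → ℝ → ℝ) (T : ℝ) (E : Set (LPVSystem np nin)) (N : ℕ) (r : ℝ) :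
    Set (Fin N → DataPoint 𝒰 𝒮 𝒴) :=
  {S | ∀ G ∈ E, trueRisk D loss T G - empiricalRisk S loss T G ≤ r}

end Risk

/-- `c = 2 K_ℓ max {L_u (np + 1) c_E, c_y}`. -/
def boundConst (np : ℕ) (Kl Lu cE cy : ℝ) : ℝ :=
  2 * Kl * max (Lu * ((np : ℝ) + 1) * cE) cy

/-- `R(δ) = c (2 + 4 √(2 log (4 / δ)))`. -/
def boundR (c δ : ℝ) : ℝ :=
  c * (2 + 4 * √(2 * Real.log (4 / δ)))

end

/-! The output at time `T` is linear in the system in a suitable sense. Expanding the state in its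
Volterra series writes it as an inner product in one fixed L² space, the disjoint union over all
indices of the time simplices. One factor is the family of weighted Volterra kernels, whose norm is
exactly the weighted H₂ norm. The other is built from the signals and carries the compensating
factor `e^{-λτ/2}` (`LPVSystem.output_eq_inner`). Its norm is at most `L_u (np + 1)`: the scheduling
factors are bounded by 1, the `np ^ k` multi-indices and the simplex density `t ^ k / k!` sum to
`e^{np t}`, and `λ ≥ np` cancels this growth. So `T` does not enter
(`LPVSystem.lintegral_featureFun_sq_le`).

What remains is a uniform law for bounded linear predictors with a Lipschitz loss
(`uniform_deviation_linear_class`). It is proved through the exponential moment of the supremum of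
the deviations, one observation at a time. Jensen's inequality with an independent copy symmetrizes
the observation. The contraction principle for `exp` (`iSup_eexp_contraction`) then replaces the
loss by a linear functional `⟪W, Φ z⟫`, which is absorbed into an accumulated vector `v`. The
inequality `cosh ‖v + x‖ + cosh ‖v - x‖ ≤ 2 cosh ‖v‖ cosh ‖x‖` controls the growth of the moment,
with one factor `cosh` per observation. Markov's inequality and `cosh x ≤ exp (x² / 2)` give a
sub-Gaussian tail.

The class of systems may be uncountable. Separability of the L² space and Lipschitz dependence of
the risks on the kernel vector reduce it to a countable subfamily, which also gives measurability of
the event. -/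

/-! ### Inequalities for cosh and exp; the contraction principle -/

/-- Symmetric spreading increases the sum of powers. -/
lemma add_pow_add_sub_pow_le {P q Q : ℝ} (hq : |q| ≤ Q) (hQ : Q ≤ P) (n : ℕ) :
    (P + q) ^ n + (P - q) ^ n ≤ (P + Q) ^ n + (P - Q) ^ n := by
  obtain ⟨h1, h2⟩ := abs_le.1 hq
  rcases (abs_nonneg q |>.trans hq).eq_or_lt with h0 | h0
  · have : q = 0 := by rw [← h0] at hq; simpa using hq
    rw [this, ← h0]
  · have hc := convexOn_pow (𝕜 := ℝ) n
    have hp : P + Q ∈ Ici (0 : ℝ) := by simp only [mem_Ici]; linarith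
    have hm : P - Q ∈ Ici (0 : ℝ) := by simp only [mem_Ici]; linarith
    -- `P ± q` are convex combinations of `P + Q` and `P - Q` with the weights `(1 ± q / Q) / 2`, in
    -- the two possible orders.
    have hθ : 0 ≤ (1 + q / Q) / 2 := by
      have : -1 ≤ q / Q := by rw [le_div_iff₀ h0]; linarith
      linarith
    have hθ' : 0 ≤ (1 - q / Q) / 2 := by
      have : q / Q ≤ 1 := by rw [div_le_iff₀ h0]; linarith
      linarith
    have e1 := hc.2 hp hm hθ hθ' (by ring)
    have e2 := hc.2 hp hm hθ' hθ (by ring)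
    simp only [smul_eq_mul] at e1 e2
    have a1 : (1 + q / Q) / 2 * (P + Q) + (1 - q / Q) / 2 * (P - Q) = P + q := by
      field_simp; ring
    have a2 : (1 - q / Q) / 2 * (P + Q) + (1 + q / Q) / 2 * (P - Q) = P - q := by
      field_simp; ring
    rw [a1] at e1
    rw [a2] at e2
    linarith

/-- In an inner product space, `cosh ‖v + x‖ + cosh ‖v - x‖ ≤ 2 cosh ‖v‖ cosh ‖x‖`. -/
lemma cosh_norm_add_add_cosh_norm_sub_le {V : Type*} [NormedAddCommGroup V]
    [InnerProductSpace ℝ V] (v x : V) :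
    Real.cosh ‖v + x‖ + Real.cosh ‖v - x‖ ≤ 2 * (Real.cosh ‖v‖ * Real.cosh ‖x‖) := by
  have e : 2 * (Real.cosh ‖v‖ * Real.cosh ‖x‖) =
      Real.cosh (‖v‖ + ‖x‖) + Real.cosh (‖v‖ - ‖x‖) := by
    rw [Real.cosh_add, Real.cosh_sub]; ring
  rw [e]
  -- The even power series are compared term by term: `‖v ± x‖ ^ 2 = P ± q` and `(‖v‖ ± ‖x‖) ^ 2 = P
  -- ± Q`, where `P = ‖v‖ ^ 2 + ‖x‖ ^ 2`, and `|q| ≤ Q` is the Cauchy–Schwarz inequality.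
  refine hasSum_le (fun n => ?_) ((Real.hasSum_cosh ‖v + x‖).add (Real.hasSum_cosh ‖v - x‖))
    ((Real.hasSum_cosh (‖v‖ + ‖x‖)).add (Real.hasSum_cosh (‖v‖ - ‖x‖)))
  rw [← add_div, ← add_div]
  refine div_le_div_of_nonneg_right ?_ (by positivity)
  simp only [pow_mul]
  rw [norm_add_sq_real, norm_sub_sq_real]
  have h1 := abs_real_inner_le_norm v x
  have := add_pow_add_sub_pow_le (P := ‖v‖ ^ 2 + ‖x‖ ^ 2) (q := 2 * inner ℝ v x)
    (Q := 2 * (‖v‖ * ‖x‖)) (by rw [abs_mul, abs_two]; linarith)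
    (by nlinarith [sq_nonneg (‖v‖ - ‖x‖)]) n
  convert this using 2 <;> congr 1 <;> ring

/-- The pointwise estimate behind the contraction principle. -/
lemma exp_add_exp_le_of_contraction {hi hj fi fj gi gj : ℝ}
    (h1 : hj + fj ≤ hi + fi) (h2 : hi - fi ≤ hj - fj)
    (hfi : |fi| ≤ |gi|) (hfj : |fj| ≤ |gj|) (hij : |fi - fj| ≤ |gi - gj|) :
    Real.exp (hi + fi) + Real.exp (hj - fj) ≤ Real.exp (hi + gi) + Real.exp (hj - gj) ∨
    Real.exp (hi + fi) + Real.exp (hj - fj) ≤ Real.exp (hi - gi) + Real.exp (hj + gj) := by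
  -- Convexity of `exp`: a nonnegative increment counts for more from a higher base point.
  have key : ∀ {a b x y : ℝ}, a ≤ b → 0 ≤ y → x ≤ y →
      Real.exp (a + x) - Real.exp a ≤ Real.exp (b + y) - Real.exp b := by
    intro a b x y hab hy hxy
    have e1 : Real.exp (a + x) - Real.exp a = Real.exp a * (Real.exp x - 1) := by
      rw [Real.exp_add]; ring
    have e2 : Real.exp (b + y) - Real.exp b = Real.exp b * (Real.exp y - 1) := by
      rw [Real.exp_add]; ring
    rw [e1, e2]
    have i1 : Real.exp x ≤ Real.exp y := Real.exp_le_exp.2 hxy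
    have i2 : 1 ≤ Real.exp y := Real.one_le_exp hy
    have i3 := Real.exp_le_exp.2 hab
    have i4 := Real.exp_pos a
    nlinarith
  -- the case in which `gi, gj ≥ 0`
  have pos : ∀ {gi gj : ℝ}, 0 ≤ gi → 0 ≤ gj → |fi| ≤ gi → |fj| ≤ gj → |fi - fj| ≤ |gi - gj| →
      Real.exp (hi + fi) + Real.exp (hj - fj) ≤ Real.exp (hi + gi) + Real.exp (hj - gj) ∨
      Real.exp (hi + fi) + Real.exp (hj - fj) ≤ Real.exp (hi - gi) + Real.exp (hj + gj) := by
    intro gi gj _ _ hfi hfj hij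
    obtain ⟨a1, a2⟩ := abs_le.1 hfi
    obtain ⟨b1, b2⟩ := abs_le.1 hfj
    -- The larger of `gi`, `gj` takes the plus sign. If it is `gi`, then `gj - fj ≤ gi - fi`, and
    -- the base points satisfy `hj - gj ≤ hj + fj ≤ hi + fi`.
    rcases le_total gj gi with h | h
    · left
      rw [abs_of_nonneg (sub_nonneg.2 h)] at hij
      obtain ⟨c1, c2⟩ := abs_le.1 hij
      have := key (a := hj - gj) (b := hi + fi) (x := gj - fj) (y := gi - fi)
        (by linarith) (by linarith) (by linarith)
      rw [show hj - gj + (gj - fj) = hj - fj by ring, show hi + fi + (gi - fi) = hi + gi by ring]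
        at this
      linarith
    · right
      rw [abs_of_nonpos (sub_nonpos.2 h)] at hij
      obtain ⟨c1, c2⟩ := abs_le.1 hij
      have := key (a := hi - gi) (b := hj - fj) (x := gi + fi) (y := gj + fj)
        (by linarith) (by linarith) (by linarith)
      rw [show hi - gi + (gi + fi) = hi + fi by ring, show hj - fj + (gj + fj) = hj + gj by ring]
        at this
      linarith
  obtain ⟨a1, a2⟩ := abs_le.1 hfi
  obtain ⟨b1, b2⟩ := abs_le.1 hfj
  -- For opposite signs monotonicity of `exp` suffices; if both are nonpositive, negating `gi` and
  -- `gj` exchanges the two alternatives.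
  rcases le_total 0 gi with hi0 | hi0 <;> rcases le_total 0 gj with hj0 | hj0
  · rw [abs_of_nonneg hi0] at hfi
    rw [abs_of_nonneg hj0] at hfj
    exact pos hi0 hj0 hfi hfj hij
  · left
    rw [abs_of_nonneg hi0] at a2
    rw [abs_of_nonpos hj0] at b1
    exact add_le_add (Real.exp_le_exp.2 (by linarith)) (Real.exp_le_exp.2 (by linarith))
  · right
    rw [abs_of_nonpos hi0] at a2
    rw [abs_of_nonneg hj0] at b1
    exact add_le_add (Real.exp_le_exp.2 (by linarith)) (Real.exp_le_exp.2 (by linarith))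
  · rw [abs_of_nonpos hi0] at hfi
    rw [abs_of_nonpos hj0] at hfj
    have := pos (gi := -gi) (gj := -gj) (by linarith) (by linarith) hfi hfj
      (by rwa [show -gi - -gj = -(gi - gj) by ring, abs_neg])
    simpa only [sub_neg_eq_add, ← sub_eq_add_neg, or_comm] using this

/-- `exp` as an extended nonnegative real. -/
noncomputable abbrev eexp (x : ℝ) : ℝ≥0∞ := ENNReal.ofReal (Real.exp x)

lemma eexp_mono {x y : ℝ} (h : x ≤ y) : eexp x ≤ eexp y :=
  ENNReal.ofReal_le_ofReal (Real.exp_le_exp.2 h)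

lemma eexp_add_le {a b c d : ℝ}
    (h : Real.exp a + Real.exp b ≤ Real.exp c + Real.exp d) :
    eexp a + eexp b ≤ eexp c + eexp d := by
  rw [← ENNReal.ofReal_add (Real.exp_nonneg _) (Real.exp_nonneg _),
    ← ENNReal.ofReal_add (Real.exp_nonneg _) (Real.exp_nonneg _)]
  exact ENNReal.ofReal_le_ofReal h

lemma exp_add_add_exp_sub_le {h f g : ℝ} (hfg : |f| ≤ |g|) :
    Real.exp (h + f) + Real.exp (h - f) ≤ Real.exp (h + g) + Real.exp (h - g) := by
  have e : ∀ x : ℝ, Real.exp (h + x) + Real.exp (h - x) = 2 * Real.exp h * Real.cosh x := by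
    intro x
    rw [sub_eq_add_neg, Real.exp_add, Real.exp_add, Real.cosh_eq]
    ring
  rw [e, e]
  have := Real.cosh_le_cosh.2 hfg
  gcongr

/-- The contraction principle for one Rademacher sign and the exponential function. -/
lemma iSup_eexp_contraction {ι : Type*} (h f g : ι → ℝ) (hfg : ∀ i, |f i| ≤ |g i|)
    (hfg' : ∀ i j, |f i - f j| ≤ |g i - g j|) :
    (⨆ i, eexp (h i + f i)) + (⨆ i, eexp (h i - f i)) ≤
      (⨆ i, eexp (h i + g i)) + (⨆ i, eexp (h i - g i)) := by
  rcases isEmpty_or_nonempty ι with _ | _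
  · simp
  have two : ∀ i j, eexp (h i + g i) + eexp (h j - g j) ≤
      (⨆ i, eexp (h i + g i)) + (⨆ i, eexp (h i - g i)) := fun i j =>
    add_le_add (le_iSup (fun i => eexp (h i + g i)) i) (le_iSup (fun i => eexp (h i - g i)) j)
  refine ENNReal.iSup_add_iSup_le fun i j => ?_
  have diag : ∀ k, eexp (h k + f k) + eexp (h k - f k) ≤
      (⨆ i, eexp (h i + g i)) + (⨆ i, eexp (h i - g i)) := fun k =>
    (eexp_add_le (exp_add_add_exp_sub_le (hfg k))).trans (two k k)
  -- If the same index is the better one in both suprema, the sum is bounded by its diagonal term,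
  -- where only `|f| ≤ |g|` matters. Otherwise the indices cross and the increment condition is
  -- used.
  rcases le_total (h j + f j) (h i + f i) with h1 | h1
  · rcases le_total (h i - f i) (h j - f j) with h2 | h2
    · rcases exp_add_exp_le_of_contraction h1 h2 (hfg i) (hfg j) (hfg' i j) with h3 | h3
      · exact (eexp_add_le h3).trans (two i j)
      · rw [add_comm (Real.exp (h i - g i))] at h3
        exact (eexp_add_le h3).trans (two j i)
    · exact (add_le_add_right (eexp_mono h2) _).trans (diag i)
  · exact (add_le_add_left (eexp_mono h1) _).trans (diag j)

/-! ### Symmetrization and exponential moments of suprema -/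

section Symmetrization

variable {Z : Type*} [MeasurableSpace Z] {D : Measure Z} [IsProbabilityMeasure D]

lemma measurable_eexp {g : Z → ℝ} (hg : Measurable g) : Measurable fun z => eexp (g z) :=
  (Real.measurable_exp.comp hg).ennreal_ofReal

/-- Jensen's inequality for the exponential function. -/
lemma eexp_integral_le {g : Z → ℝ} (hg : Measurable g) {M : ℝ} (hM : ∀ z, |g z| ≤ M) :
    eexp (∫ z, g z ∂D) ≤ ∫⁻ z, eexp (g z) ∂D := by
  have hi : Integrable g D := Integrable.of_bound hg.aestronglyMeasurable M (ae_of_all _ hM)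
  have hi' : Integrable (fun z => Real.exp (g z)) D :=
    Integrable.of_bound (Real.measurable_exp.comp hg).aestronglyMeasurable (Real.exp M)
      (ae_of_all _ fun z => by
        rw [Real.norm_eq_abs, Real.abs_exp]
        exact Real.exp_le_exp.2 ((le_abs_self _).trans (hM z)))
  have := convexOn_exp.map_integral_le (μ := D) (f := g) Real.continuous_exp.continuousOn
    isClosed_univ (ae_of_all _ fun _ => mem_univ _) hi hi'
  rw [← ofReal_integral_eq_lintegral_ofReal hi' (ae_of_all _ fun z => Real.exp_nonneg _)]
  exact ENNReal.ofReal_le_ofReal this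

lemma eexp_add_half_le (x y : ℝ) : eexp (x + y) ≤ 2⁻¹ * (eexp (2 * x) + eexp (2 * y)) := by
  have h2 : (2⁻¹ : ℝ≥0∞) = ENNReal.ofReal 2⁻¹ := by
    rw [ENNReal.ofReal_inv_of_pos two_pos]; simp
  rw [← ENNReal.ofReal_add (Real.exp_nonneg _) (Real.exp_nonneg _), h2,
    ← ENNReal.ofReal_mul (by norm_num)]
  refine ENNReal.ofReal_le_ofReal ?_
  rw [Real.exp_add, two_mul, two_mul, Real.exp_add, Real.exp_add]
  nlinarith [sq_nonneg (Real.exp x - Real.exp y)]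

variable {ι : Type*} [Countable ι]

/-- Symmetrization of one observation in the exponential moment of a supremum. -/
lemma lintegral_iSup_eexp_symmetrization (h : ι → ℝ) {f : ι → Z → ℝ}
    (hf : ∀ i, Measurable (f i)) {M : ℝ} (hM : ∀ i z, |f i z| ≤ M) (s : ℝ) :
    ∫⁻ z, ⨆ i, eexp (h i + s * (∫ z', f i z' ∂D - f i z)) ∂D ≤
      ∫⁻ z, 2⁻¹ * ((⨆ i, eexp (h i + 2 * s * f i z)) + ⨆ i, eexp (h i - 2 * s * f i z)) ∂D := by
  have mp : Measurable fun z => ⨆ i, eexp (h i + 2 * s * f i z) :=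
    Measurable.iSup fun i => measurable_eexp (((hf i).const_mul _).const_add _)
  have mm : Measurable fun z => ⨆ i, eexp (h i - 2 * s * f i z) :=
    Measurable.iSup fun i => measurable_eexp (((hf i).const_mul _).const_sub _)
  calc ∫⁻ z, ⨆ i, eexp (h i + s * (∫ z', f i z' ∂D - f i z)) ∂D
      ≤ ∫⁻ z, ∫⁻ z', 2⁻¹ * ((⨆ i, eexp (h i + 2 * s * f i z')) +
          ⨆ i, eexp (h i - 2 * s * f i z)) ∂D ∂D := by
        -- The mean of `f i` becomes an average over an independent copy `z'`, which Jensen's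
        -- inequality moves out of the exponential.
        refine lintegral_mono fun z => iSup_le fun i => ?_
        have hi : Integrable (f i) D :=
          Integrable.of_bound (hf i).aestronglyMeasurable M (ae_of_all _ (hM i))
        have e : h i + s * (∫ z', f i z' ∂D - f i z) =
            ∫ z', (h i + s * (f i z' - f i z)) ∂D := by
          have hi2 : Integrable (fun z' => f i z' - f i z) D := hi.sub (integrable_const _)
          rw [integral_add (integrable_const _) (hi2.const_mul _), integral_const_mul,
            integral_sub hi (integrable_const _)]
          simp
        rw [e]
        refine (eexp_integral_le (M := |h i| + |s| * (M + M))
          ((((hf i).sub_const _).const_mul _).const_add _) fun z' => ?_).trans ?_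
        · refine (abs_add_le _ _).trans (add_le_add le_rfl ?_)
          rw [abs_mul]
          exact mul_le_mul_of_nonneg_left
            ((abs_sub _ _).trans (add_le_add (hM i z') (hM i z))) (abs_nonneg _)
        · refine lintegral_mono fun z' => ?_
          -- Each copy receives half of `h i`, so that doubling the exponents restores `h i` and
          -- produces `2 * s`.
          rw [show h i + s * (f i z' - f i z) =
            (h i / 2 + s * f i z') + (h i / 2 - s * f i z) by ring]
          refine (eexp_add_half_le _ _).trans ?_
          rw [show 2 * (h i / 2 + s * f i z') = h i + 2 * s * f i z' by ring,
            show 2 * (h i / 2 - s * f i z) = h i - 2 * s * f i z by ring]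
          gcongr
          · exact le_iSup (fun i => eexp (h i + 2 * s * f i z')) i
          · exact le_iSup (fun i => eexp (h i - 2 * s * f i z)) i
    _ = ∫⁻ z, 2⁻¹ * ((∫⁻ z', (⨆ i, eexp (h i + 2 * s * f i z')) ∂D) +
          ⨆ i, eexp (h i - 2 * s * f i z)) ∂D := by
        refine lintegral_congr fun z => ?_
        rw [lintegral_const_mul' _ _ (by simp), lintegral_add_left mp]
        simp
    _ = _ := by
        rw [lintegral_const_mul' _ _ (by simp), lintegral_const_mul' _ _ (by simp),
          lintegral_add_right _ mm, lintegral_add_left mp]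
        simp

/-- Exponential moment bound for the uniform deviation of the empirical means of a family of
functions that is dominated by a family of linear functionals. -/
lemma lintegral_iSup_eexp_deviation_le {V : Type*} [NormedAddCommGroup V]
    [InnerProductSpace ℝ V] {f : ι → Z → ℝ} (hf : ∀ i, Measurable (f i)) {M : ℝ}
    (hM : ∀ i z, |f i z| ≤ M) {W : ι → V} {Φ : Z → V} {a b : ℝ} (ha : 0 ≤ a)
    (hW : ∀ i, ‖W i‖ ≤ a) (hΦ : ∀ z, ‖Φ z‖ ≤ b)
    (hfW : ∀ i z, |f i z| ≤ |inner ℝ (W i) (Φ z)|)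
    (hfW' : ∀ i j z, |f i z - f j z| ≤ |inner ℝ (W i) (Φ z) - inner ℝ (W j) (Φ z)|)
    {s : ℝ} (hs : 0 ≤ s) (N : ℕ) (v : V) :
    ∫⁻ S, ⨆ i, eexp (inner ℝ (W i) v + s * ∑ n, (∫ z', f i z' ∂D - f i (S n)))
      ∂(Measure.pi fun _ : Fin N => D) ≤
      ENNReal.ofReal (2 * Real.cosh (a * ‖v‖) * Real.cosh (2 * s * (a * b)) ^ N) := by
  -- `v` is the signed sum of the features of the observations already linearized; each step changes
  -- it, so the induction must cover all `v`.
  induction N generalizing v with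
  | zero =>
    simp only [Finset.univ_eq_empty, Finset.sum_empty, mul_zero, add_zero, pow_zero, mul_one,
      lintegral_const, measure_univ]
    refine iSup_le fun i => ENNReal.ofReal_le_ofReal ?_
    -- The supremum is only estimated here, after all observations are used up: `exp (a * ‖v‖) ≤ 2 *
    -- cosh (a * ‖v‖)` costs the factor 2 once.
    have h1 : inner ℝ (W i) v ≤ a * ‖v‖ :=
      (real_inner_le_norm _ _).trans (mul_le_mul_of_nonneg_right (hW i) (norm_nonneg _))
    rw [Real.cosh_eq]
    have := Real.exp_le_exp.2 h1
    have := Real.exp_pos (-(a * ‖v‖))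
    linarith
  | succ N ih =>
    set c : ℝ := Real.cosh (2 * s * (a * b)) with hc
    have hc0 : 0 ≤ c := (Real.cosh_pos _).le
    have hmeas : Measurable fun q : Z × (Fin N → Z) =>
        ⨆ i, eexp (inner ℝ (W i) v + s * ∑ n, (∫ z', f i z' ∂D - f i (q.2 n)) +
          s * (∫ z', f i z' ∂D - f i q.1)) := by
      refine Measurable.iSup fun i => measurable_eexp ?_
      have := hf i
      fun_prop
    have hmeas2 : Measurable fun q : Z × (Fin N → Z) => 2⁻¹ *
        ((⨆ i, eexp (inner ℝ (W i) v + s * ∑ n, (∫ z', f i z' ∂D - f i (q.2 n)) +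
            2 * s * f i q.1)) +
          ⨆ i, eexp (inner ℝ (W i) v + s * ∑ n, (∫ z', f i z' ∂D - f i (q.2 n)) -
            2 * s * f i q.1)) := by
      refine (Measurable.add (Measurable.iSup fun i => measurable_eexp ?_)
        (Measurable.iSup fun i => measurable_eexp ?_)).const_mul _ <;>
      · have := hf i
        fun_prop
    have mp := measurePreserving_piFinSuccAbove (fun _ : Fin (N + 1) => D) 0
    have hmS : ∀ w : V, Measurable fun S : Fin N → Z =>
        ⨆ i, eexp (inner ℝ (W i) w + s * ∑ n, (∫ z', f i z' ∂D - f i (S n))) := by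
      intro w
      refine Measurable.iSup fun i => measurable_eexp ?_
      have := hf i
      fun_prop
    calc ∫⁻ S, ⨆ i, eexp (inner ℝ (W i) v + s * ∑ n, (∫ z', f i z' ∂D - f i (S n)))
          ∂(Measure.pi fun _ : Fin (N + 1) => D)
        = ∫⁻ q, ⨆ i, eexp (inner ℝ (W i) v + s * ∑ n, (∫ z', f i z' ∂D - f i (q.2 n)) +
          s * (∫ z', f i z' ∂D - f i q.1)) ∂(D.prod (Measure.pi fun _ : Fin N => D)) := by
          rw [← mp.lintegral_comp hmeas]
          refine lintegral_congr fun S => iSup_congr fun i => ?_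
          rw [Fin.sum_univ_succ]
          simp only [MeasurableEquiv.piFinSuccAbove_apply, Fin.insertNthEquiv_symm_apply,
            Fin.removeNth_apply, Fin.zero_succAbove]
          refine congrArg eexp ?_
          ring
      _ = ∫⁻ S, ∫⁻ z, ⨆ i, eexp (inner ℝ (W i) v + s * ∑ n, (∫ z', f i z' ∂D - f i (S n)) +
          s * (∫ z', f i z' ∂D - f i z)) ∂D ∂(Measure.pi fun _ : Fin N => D) :=
          lintegral_prod_symm _ hmeas.aemeasurable
      _ ≤ ∫⁻ S, ∫⁻ z, 2⁻¹ *
        ((⨆ i, eexp (inner ℝ (W i) v + s * ∑ n, (∫ z', f i z' ∂D - f i (S n)) +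
            2 * s * f i z)) +
          ⨆ i, eexp (inner ℝ (W i) v + s * ∑ n, (∫ z', f i z' ∂D - f i (S n)) -
            2 * s * f i z)) ∂D ∂(Measure.pi fun _ : Fin N => D) :=
          lintegral_mono fun S => lintegral_iSup_eexp_symmetrization _ hf hM s
      -- The order of integration is exchanged while the integrand still involves `f` only: `Φ` is
      -- not assumed measurable, and from here on it is evaluated at a fixed `z`.
      _ = ∫⁻ z, ∫⁻ S, 2⁻¹ *
        ((⨆ i, eexp (inner ℝ (W i) v + s * ∑ n, (∫ z', f i z' ∂D - f i (S n)) +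
            2 * s * f i z)) +
          ⨆ i, eexp (inner ℝ (W i) v + s * ∑ n, (∫ z', f i z' ∂D - f i (S n)) -
            2 * s * f i z)) ∂(Measure.pi fun _ : Fin N => D) ∂D := by
          rw [← lintegral_prod_symm _ hmeas2.aemeasurable, lintegral_prod _ hmeas2.aemeasurable]
      _ ≤ ∫⁻ z, ∫⁻ S, 2⁻¹ *
        ((⨆ i, eexp (inner ℝ (W i) (v + (2 * s) • Φ z) +
            s * ∑ n, (∫ z', f i z' ∂D - f i (S n)))) +
          ⨆ i, eexp (inner ℝ (W i) (v - (2 * s) • Φ z) +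
            s * ∑ n, (∫ z', f i z' ∂D - f i (S n)))) ∂(Measure.pi fun _ : Fin N => D) ∂D := by
          refine lintegral_mono fun z => lintegral_mono fun S => ?_
          refine mul_le_mul_right ?_ _
          refine (iSup_eexp_contraction
            (fun i => inner ℝ (W i) v + s * ∑ n, (∫ z', f i z' ∂D - f i (S n)))
            (fun i => 2 * s * f i z) (fun i => 2 * s * inner ℝ (W i) (Φ z)) ?_ ?_).trans_eq ?_
          · intro i
            rw [abs_mul, abs_mul (2 * s)]
            exact mul_le_mul_of_nonneg_left (hfW i z) (abs_nonneg _)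
          · intro i j
            rw [← mul_sub, ← mul_sub, abs_mul, abs_mul (2 * s)]
            exact mul_le_mul_of_nonneg_left (hfW' i j z) (abs_nonneg _)
          · congr 1 <;>
            · refine iSup_congr fun i => ?_
              first | rw [inner_add_right] | rw [inner_sub_right]
              rw [real_inner_smul_right]
              refine congrArg eexp ?_
              ring
      _ ≤ ∫⁻ _, ENNReal.ofReal (2 * Real.cosh (a * ‖v‖) * c ^ (N + 1)) ∂D := by
          refine lintegral_mono fun z => ?_
          rw [lintegral_const_mul' _ _ (by simp), lintegral_add_left (hmS _)]
          refine (mul_le_mul_right (add_le_add (ih _) (ih _)) _).trans ?_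
          have h2 : (2⁻¹ : ℝ≥0∞) = ENNReal.ofReal 2⁻¹ := by
            rw [ENNReal.ofReal_inv_of_pos two_pos]; simp
          have hcp : ∀ x, 0 ≤ 2 * Real.cosh x * c ^ N := fun x =>
            mul_nonneg (by have := Real.cosh_pos x; linarith) (pow_nonneg hc0 _)
          rw [h2, ← ENNReal.ofReal_add (hcp _) (hcp _), ← ENNReal.ofReal_mul (by norm_num)]
          refine ENNReal.ofReal_le_ofReal ?_
          have hn : ∀ w : V, a * ‖w‖ = ‖a • w‖ := fun w => by
            rw [norm_smul, Real.norm_of_nonneg ha]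
          -- The induction hypothesis was applied to `v + (2 * s) • Φ z` and `v - (2 * s) • Φ z`;
          -- averaging the two bounds factors out `cosh (a * ‖v‖)`.
          have key := cosh_norm_add_add_cosh_norm_sub_le (a • v) (a • (2 * s) • Φ z)
          rw [← smul_add, ← smul_sub, ← hn, ← hn, ← hn, ← hn] at key
          have k2 : Real.cosh (a * ‖(2 * s) • Φ z‖) ≤ c := by
            refine Real.cosh_le_cosh.2 ?_
            have hb : 0 ≤ b := (norm_nonneg _).trans (hΦ z)
            rw [abs_of_nonneg (by positivity), abs_of_nonneg (by positivity), norm_smul,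
              Real.norm_of_nonneg (by positivity)]
            have := mul_le_mul_of_nonneg_left (hΦ z) (by positivity : 0 ≤ 2 * s * a)
            linarith
          have k3 := mul_le_mul_of_nonneg_left k2 (Real.cosh_pos (a * ‖v‖)).le
          have hcN : 0 ≤ c ^ N := pow_nonneg hc0 _
          rw [pow_succ]
          have := mul_le_mul_of_nonneg_right (key.trans (mul_le_mul_of_nonneg_left k3 two_pos.le)) hcN
          linarith
      _ = _ := by simp

/-- Tail bound for the uniform deviation of empirical means. -/
lemma measure_exists_deviation_gt_le {V : Type*} [NormedAddCommGroup V]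
    [InnerProductSpace ℝ V] {f : ι → Z → ℝ} (hf : ∀ i, Measurable (f i)) {M : ℝ}
    (hM : ∀ i z, |f i z| ≤ M) {W : ι → V} {Φ : Z → V} {a b : ℝ} (ha : 0 ≤ a)
    (hW : ∀ i, ‖W i‖ ≤ a) (hΦ : ∀ z, ‖Φ z‖ ≤ b)
    (hfW : ∀ i z, |f i z| ≤ |inner ℝ (W i) (Φ z)|)
    (hfW' : ∀ i j z, |f i z - f j z| ≤ |inner ℝ (W i) (Φ z) - inner ℝ (W j) (Φ z)|)
    {s : ℝ} (hs : 0 ≤ s) (N : ℕ) (t : ℝ) :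
    (Measure.pi fun _ : Fin N => D)
      {S | ∃ i, t < ∑ n, (∫ z', f i z' ∂D - f i (S n))} ≤
      ENNReal.ofReal (2 * Real.exp (N * (2 * s * (a * b)) ^ 2 / 2 - s * t)) := by
  have hm : Measurable fun S : Fin N → Z =>
      ⨆ i, eexp (inner ℝ (W i) 0 + s * ∑ n, (∫ z', f i z' ∂D - f i (S n))) := by
    refine Measurable.iSup fun i => measurable_eexp ?_
    have := hf i
    fun_prop
  have h1 : {S : Fin N → Z | ∃ i, t < ∑ n, (∫ z', f i z' ∂D - f i (S n))} ⊆
      {S | eexp (s * t) ≤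
        ⨆ i, eexp (inner ℝ (W i) 0 + s * ∑ n, (∫ z', f i z' ∂D - f i (S n)))} := by
    rintro S ⟨i, hi⟩
    refine le_trans (eexp_mono ?_)
      (le_iSup (fun i => eexp (inner ℝ (W i) 0 + s * ∑ n, (∫ z', f i z' ∂D - f i (S n)))) i)
    rw [inner_zero_right, zero_add]
    exact mul_le_mul_of_nonneg_left hi.le hs
  refine (measure_mono h1).trans ((meas_ge_le_lintegral_div hm.aemeasurable
    (by simpa using Real.exp_pos (s * t)) ENNReal.ofReal_ne_top).trans ?_)
  refine (ENNReal.div_le_div_right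
    (lintegral_iSup_eexp_deviation_le hf hM ha hW hΦ hfW hfW' hs N 0) _).trans ?_
  rw [← ENNReal.ofReal_div_of_pos (Real.exp_pos _)]
  refine ENNReal.ofReal_le_ofReal ?_
  rw [div_le_iff₀ (Real.exp_pos _), mul_assoc 2 (Real.exp _), ← Real.exp_add, norm_zero, mul_zero,
    Real.cosh_zero, mul_one]
  refine mul_le_mul_of_nonneg_left ?_ two_pos.le
  calc Real.cosh (2 * s * (a * b)) ^ N ≤ Real.exp ((2 * s * (a * b)) ^ 2 / 2) ^ N :=
        pow_le_pow_left₀ (Real.cosh_pos _).le (Real.cosh_le_exp_half_sq _) _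
    _ = _ := by
        rw [← Real.exp_nat_mul]
        congr 1
        ring

end Symmetrization

/-! ### Uniform deviation for bounded linear predictors -/

section UniformDeviation

/-- `α` is the scale of the coordinate that carries the label. The choice balancing the two cross
terms, `α ^ 2 = e * y / r`, degenerates when `e`, `y` or `r` vanishes. Taking `α = e + m / (r + 1)`
keeps `α` positive with `e ≤ α` and `α * r ≤ 2 * m`. The four terms of the squared product are then
at most `m²`, `4 m²`, `m²`, `m²`, so the constant 4 is generous. -/
lemma exists_balanced_scale {e r y m : ℝ} (he : 0 ≤ e) (hr : 0 ≤ r) (hy : 0 ≤ y) (hm : 0 < m)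
    (h1 : r * e ≤ m) (h2 : y ≤ m) :
    ∃ α : ℝ, 0 < α ∧ √(e ^ 2 + α ^ 2) * √(r ^ 2 + (y / α) ^ 2) ≤ 4 * m := by
  have hr1 : 0 < r + 1 := by linarith
  have hα : 0 < e + m / (r + 1) := by positivity
  refine ⟨e + m / (r + 1), hα, ?_⟩
  set α := e + m / (r + 1) with hαdef
  have a1 : e ≤ α := by rw [hαdef]; have : 0 ≤ m / (r + 1) := by positivity
                        linarith
  have a2 : α * r ≤ 2 * m := by
    have : m / (r + 1) * r ≤ m := by
      rw [div_mul_eq_mul_div, div_le_iff₀ hr1]; nlinarith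
    rw [hαdef, add_mul]; linarith
  have a3 : e * (y / α) ≤ m := by
    rw [mul_div_assoc', div_le_iff₀ hα]; nlinarith
  have a4 : α * (y / α) = y := by field_simp
  have hya : 0 ≤ y / α := by positivity
  rw [← Real.sqrt_mul (by positivity)]
  refine Real.sqrt_le_iff.2 ⟨by linarith, ?_⟩
  have b1 : (e * r) ^ 2 ≤ m ^ 2 := by
    refine pow_le_pow_left₀ (by positivity) (by linarith) _
  have b2 : (α * r) ^ 2 ≤ (2 * m) ^ 2 := pow_le_pow_left₀ (by positivity) a2 _
  have b3 : (e * (y / α)) ^ 2 ≤ m ^ 2 := pow_le_pow_left₀ (by positivity) a3 _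
  have b4 : (α * (y / α)) ^ 2 ≤ m ^ 2 := by rw [a4]; exact pow_le_pow_left₀ hy h2 _
  nlinarith

/-- With `κ = 2 * c` the exponent is `8 N c² s² - s t`. It is minimal at `s = t / (16 N c²)`, with
value `-t² / (32 N c²)`. The part `4 √(2 L)` of the threshold already gives `t² ≥ 32 N c² L`; the
summand 2 is slack, and the resulting bound is `2 e^{-L} = δ / 2`. -/
lemma two_mul_exp_tail_le {c δ : ℝ} (hc : 0 < c) (hδ : δ ∈ Ioo (0 : ℝ) 1) {N : ℕ} (hN : 0 < N)
    {κ : ℝ} (hκ0 : 0 ≤ κ) (hκ : κ ≤ 2 * c) :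
    ∃ s : ℝ, 0 ≤ s ∧ 2 * Real.exp (N * (2 * s * κ) ^ 2 / 2 -
      s * (√N * (c * (2 + 4 * √(2 * Real.log (4 / δ)))))) ≤ δ := by
  obtain ⟨h0, h1⟩ := hδ
  have hN' : (0 : ℝ) < N := by exact_mod_cast hN
  set L := Real.log (4 / δ) with hL
  have hLpos : 0 < L := Real.log_pos (by rw [lt_div_iff₀ h0]; linarith)
  set t := √N * (c * (2 + 4 * √(2 * L))) with ht
  have ht0 : 0 ≤ t := by positivity
  have ht2 : 32 * N * c ^ 2 * L ≤ t ^ 2 := by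
    have e1 : (√(N : ℝ)) ^ 2 = N := Real.sq_sqrt hN'.le
    have e2 : (√(2 * L)) ^ 2 = 2 * L := Real.sq_sqrt (by positivity)
    have e3 : (4 * √(2 * L)) ^ 2 ≤ (2 + 4 * √(2 * L)) ^ 2 :=
      pow_le_pow_left₀ (by positivity) (by linarith) _
    calc 32 * N * c ^ 2 * L = N * c ^ 2 * (4 * √(2 * L)) ^ 2 := by rw [mul_pow, e2]; ring
      _ ≤ N * c ^ 2 * (2 + 4 * √(2 * L)) ^ 2 := by gcongr
      _ = t ^ 2 := by rw [ht, mul_pow, e1]; ring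
  refine ⟨t / (16 * N * c ^ 2), by positivity, ?_⟩
  have hexp : N * (2 * (t / (16 * N * c ^ 2)) * κ) ^ 2 / 2 - t / (16 * N * c ^ 2) * t ≤ -L := by
    have hs : 0 ≤ t / (16 * N * c ^ 2) := by positivity
    have : (2 * (t / (16 * N * c ^ 2)) * κ) ^ 2 ≤ (2 * (t / (16 * N * c ^ 2)) * (2 * c)) ^ 2 :=
      pow_le_pow_left₀ (by positivity) (by gcongr) _
    calc _ ≤ N * (2 * (t / (16 * N * c ^ 2)) * (2 * c)) ^ 2 / 2 - t / (16 * N * c ^ 2) * t := by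
          gcongr
      _ = -(t ^ 2 / (32 * N * c ^ 2)) := by field_simp; ring
      _ ≤ -L := by
          rw [neg_le_neg_iff, le_div_iff₀ (by positivity)]
          linarith
  calc _ ≤ 2 * Real.exp (-L) := by gcongr
    _ = δ / 2 := by
        rw [Real.exp_neg, hL, Real.exp_log (by positivity)]
        field_simp; norm_num
    _ ≤ δ := by linarith

variable {Z : Type*} [MeasurableSpace Z] (D : Measure Z) [IsProbabilityMeasure D]
  {H : Type*} [NormedAddCommGroup H] [InnerProductSpace ℝ H] [SecondCountableTopology H]
  {γ : Type*} {w : γ → H} {φ : Z → H} {y : Z → ℝ} {loss : ℝ → ℝ → ℝ} {e r cy K : ℝ}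

/-- Uniform generalization bound for a bounded class of linear predictors in a separable inner
product space and a Lipschitz loss. -/
theorem uniform_deviation_linear_class
    (hmeas : ∀ G, Measurable fun z => loss (inner ℝ (w G) (φ z)) (y z))
    (he : 0 ≤ e) (hw : ∀ G, ‖w G‖ ≤ e) (hφ : ∀ z, ‖φ z‖ ≤ r) (hy : ∀ z, |y z| ≤ cy)
    (hLip : ∀ y₁ y₁' y₂ y₂' : ℝ, |loss y₁ y₁' - loss y₂ y₂'| ≤ K * (|y₁ - y₂| + |y₁' - y₂'|))
    (hdiag : ∀ y : ℝ, loss y y = 0) {N : ℕ} (hN : 0 < N) {δ : ℝ} (hδ : δ ∈ Ioo (0 : ℝ) 1)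
    {c : ℝ} (hc : c = 2 * K * max (r * e) cy) {A : Set (Fin N → Z)}
    (hA : A = {S | ∀ G, ∫ z, loss (inner ℝ (w G) (φ z)) (y z) ∂D -
      1 / (N : ℝ) * ∑ i, loss (inner ℝ (w G) (φ (S i))) (y (S i)) ≤
        c * (2 + 4 * √(2 * Real.log (4 / δ))) / √N}) :
    (∀ G, Integrable (fun z => loss (inner ℝ (w G) (φ z)) (y z)) D) ∧ MeasurableSet A ∧
      1 - δ ≤ (Measure.pi fun _ : Fin N => D).real A := by
  have hZ : Nonempty Z := nonempty_of_isProbabilityMeasure D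
  obtain ⟨z0⟩ := hZ
  have hr : 0 ≤ r := (norm_nonneg _).trans (hφ z0)
  have hcy : 0 ≤ cy := (abs_nonneg _).trans (hy z0)
  have hK : 0 ≤ K := by simpa using (abs_nonneg _).trans (hLip 1 0 0 0)
  have hN' : (0 : ℝ) < N := by exact_mod_cast hN
  set l : γ → Z → ℝ := fun G z => loss (inner ℝ (w G) (φ z)) (y z) with hl
  set m := max (r * e) cy with hm
  have hm0 : 0 ≤ m := hcy.trans (le_max_right _ _)
  have hin : ∀ G z, |inner ℝ (w G) (φ z)| ≤ r * e := fun G z => by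
    refine (abs_real_inner_le_norm _ _).trans ?_
    rw [mul_comm]
    exact mul_le_mul (hφ z) (hw G) (norm_nonneg _) hr
  have hl1 : ∀ G z, |l G z| ≤ K * |inner ℝ (w G) (φ z) - y z| := fun G z => by
    have := hLip (inner ℝ (w G) (φ z)) (y z) (y z) (y z)
    rwa [hdiag, sub_zero, sub_self, abs_zero, add_zero] at this
  have hl2 : ∀ G G' z, |l G z - l G' z| ≤
      K * |inner ℝ (w G) (φ z) - inner ℝ (w G') (φ z)| := fun G G' z => by
    have := hLip (inner ℝ (w G) (φ z)) (y z) (inner ℝ (w G') (φ z)) (y z)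
    rwa [sub_self, abs_zero, add_zero] at this
  have hlc : ∀ G z, |l G z| ≤ c := fun G z => by
    refine (hl1 G z).trans ?_
    have : |inner ℝ (w G) (φ z) - y z| ≤ m + m :=
      (abs_sub _ _).trans (add_le_add ((hin G z).trans (le_max_left _ _))
        ((hy z).trans (le_max_right _ _)))
    calc _ ≤ K * (m + m) := by gcongr
      _ = c := by rw [hc]; ring
  have hint : ∀ G, Integrable (l G) D := fun G =>
    Integrable.of_bound (hmeas G).aestronglyMeasurable c (ae_of_all _ (hlc G))
  have hlH : ∀ G G' z, |l G z - l G' z| ≤ K * r * ‖w G - w G'‖ := fun G G' z => by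
    refine (hl2 G G' z).trans ?_
    rw [← inner_sub_left, mul_assoc]
    refine mul_le_mul_of_nonneg_left ((abs_real_inner_le_norm _ _).trans ?_) hK
    rw [mul_comm]
    exact mul_le_mul_of_nonneg_right (hφ z) (norm_nonneg _)
  set gap : γ → (Fin N → Z) → ℝ := fun G S => ∫ z, l G z ∂D - 1 / (N : ℝ) * ∑ i, l G (S i)
    with hgap
  have hgapm : ∀ G, Measurable (gap G) := fun G => by
    have : Measurable (l G) := hmeas G
    fun_prop
  have hgapsum : ∀ G S, N * gap G S = ∑ i, (∫ z, l G z ∂D - l G (S i)) := fun G S => by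
    rw [hgap, Finset.sum_sub_distrib]
    simp only [Finset.sum_const, Finset.card_univ, Fintype.card_fin, nsmul_eq_mul]
    field_simp
  have hgapH : ∀ G G' S, gap G S ≤ gap G' S + 2 * (K * r * ‖w G - w G'‖) := fun G G' S => by
    have h1 : ∫ z, l G z ∂D - ∫ z, l G' z ∂D ≤ K * r * ‖w G - w G'‖ := by
      rw [← integral_sub (hint G) (hint G')]
      refine (integral_mono ((hint G).sub (hint G')) (integrable_const _)
        fun z => (le_abs_self _).trans (hlH G G' z)).trans_eq ?_
      simp
    have h2 : 1 / (N : ℝ) * ∑ i, l G' (S i) - 1 / (N : ℝ) * ∑ i, l G (S i) ≤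
        K * r * ‖w G - w G'‖ := by
      rw [← mul_sub, ← Finset.sum_sub_distrib, one_div, inv_mul_le_iff₀ hN']
      refine (Finset.sum_le_sum (g := fun _ => K * r * ‖w G - w G'‖) fun i _ => ?_).trans_eq
        (by simp)
      exact (le_abs_self _).trans ((abs_sub_comm _ _).trans_le (hlH G G' (S i)))
    simp only [hgap]
    linarith
  set ρ := c * (2 + 4 * √(2 * Real.log (4 / δ))) / √N with hρ
  -- reduction to a countable dense subfamily
  obtain ⟨u, hu1, hu2, hu3⟩ :=
    (TopologicalSpace.IsSeparable.of_separableSpace (range w)).exists_countable_dense_subset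
  have : Countable u := hu2.to_subtype
  have hg : ∀ i : u, ∃ G, w G = i := fun i => hu1 i.2
  choose g hg using hg
  have hAeq : A = {S | ∀ i : u, gap (g i) S ≤ ρ} := by
    rw [hA]
    ext S
    refine ⟨fun h i => h (g i), fun h G => ?_⟩
    refine le_of_forall_pos_le_add fun ε hε => ?_
    -- The gap is Lipschitz in `w G` with constant `2 * (K * r)`; adding 1 to the denominator keeps
    -- the radius defined when this constant is zero.
    obtain ⟨x, hx, hxε⟩ := Metric.mem_closure_iff.1 (hu3 (mem_range_self G))
      (ε / (2 * (K * r) + 1)) (by positivity)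
    rw [dist_eq_norm, lt_div_iff₀ (by positivity)] at hxε
    have h1 := hgapH G (g ⟨x, hx⟩) S
    have h2 := h ⟨x, hx⟩
    rw [hg] at h1
    have h3 := norm_nonneg (w G - x)
    change gap G S ≤ ρ + ε
    simp only at h1
    nlinarith
  have hAm : MeasurableSet A := by
    rw [hAeq, ofPred_forall]
    exact MeasurableSet.iInter fun i => measurableSet_le (hgapm _) measurable_const
  refine ⟨hint, hAm, ?_⟩
  have hc0 : 0 ≤ c := by rw [hc]; positivity
  -- For `c = 0` the losses vanish identically. This case is separate because the optimal `s` and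
  -- the scale `α` need `c > 0` and `m > 0`.
  rcases hc0.eq_or_lt with hc1 | hc1
  · have hl0 : ∀ G z, l G z = 0 := fun G z => by
      have := hlc G z
      rw [← hc1] at this
      simpa using this
    have : A = univ := by
      rw [hAeq]
      refine eq_univ_of_forall fun S i => ?_
      simp [hgap, hl0, hρ, ← hc1]
    rw [this, probReal_univ]
    linarith [hδ.1]
  · have hm1 : 0 < m := by
      rcases hm0.eq_or_lt with h | h
      · rw [hc, ← h] at hc1; simp at hc1
      · exact h
    obtain ⟨α, hα, hαm⟩ := exists_balanced_scale he hr hcy hm1 (le_max_left _ _) (le_max_right _ _)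
    set a := √(e ^ 2 + α ^ 2) with ha
    set b := K * √(r ^ 2 + (cy / α) ^ 2) with hb
    have hab : a * b ≤ 2 * c := by
      rw [hb, hc]
      have := mul_le_mul_of_nonneg_left hαm hK
      linarith
    obtain ⟨s, hs0, hs⟩ := two_mul_exp_tail_le hc1 hδ hN (κ := a * b) (by positivity) hab
    -- Since the loss vanishes on the diagonal, it is dominated by `K` times the residual `⟪w, φ⟫ -
    -- y`. Appending the constant coordinate `α` to the predictor makes this residual linear, and
    -- the label cancels in differences of two predictors, as contraction requires.
    have hinner : ∀ i z, inner ℝ (WithLp.toLp 2 (w i, α) : WithLp 2 (H × ℝ))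
        (WithLp.toLp 2 (K • φ z, -(K * (y z / α)))) = K * (inner ℝ (w i) (φ z) - y z) := by
      intro i z
      rw [WithLp.prod_inner_apply]
      simp only [real_inner_smul_right, RCLike.inner_apply, conj_trivial]
      field_simp
      ring
    have key := measure_exists_deviation_gt_le (D := D) (f := fun i : u => l (g i))
      (fun i => hmeas _) (fun i => hlc _) (a := a) (b := b)
      (W := fun i => (WithLp.toLp 2 (w (g i), α) : WithLp 2 (H × ℝ)))
      (Φ := fun z => WithLp.toLp 2 (K • φ z, -(K * (y z / α)))) (Real.sqrt_nonneg _) ?_ ?_ ?_ ?_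
      hs0 N (√N * (c * (2 + 4 * √(2 * Real.log (4 / δ)))))
    · have hcompl : Aᶜ = {S | ∃ i : u, √N * (c * (2 + 4 * √(2 * Real.log (4 / δ)))) <
          ∑ n, (∫ z', l (g i) z' ∂D - l (g i) (S n))} := by
        rw [hAeq]
        ext S
        simp only [mem_compl_iff, mem_ofPred_eq, not_forall, not_le]
        refine exists_congr fun i => ?_
        rw [← hgapsum, hρ, div_lt_iff₀ (by positivity)]
        have : (N : ℝ) = √N * √N := (Real.mul_self_sqrt hN'.le).symm
        rw [show (N : ℝ) * gap (g i) S = √N * (gap (g i) S * √N) by nth_rw 1 [this]; ring]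
        exact (mul_lt_mul_iff_right₀ (by positivity)).symm
      rw [← hcompl] at key
      have h1 : (Measure.pi fun _ : Fin N => D).real Aᶜ ≤ δ :=
        ENNReal.toReal_le_of_le_ofReal hδ.1.le (key.trans (ENNReal.ofReal_le_ofReal hs))
      rw [probReal_compl_eq_one_sub hAm] at h1
      linarith
    · intro i
      refine Real.le_sqrt_of_sq_le ?_
      rw [WithLp.prod_norm_sq_eq_of_L2]
      simp only [Real.norm_eq_abs, sq_abs]
      have := hw (g i)
      change ‖w (g i)‖ ^ 2 + α ^ 2 ≤ _
      gcongr
    · intro z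
      have hb' : b = √(K ^ 2 * (r ^ 2 + (cy / α) ^ 2)) := by
        rw [Real.sqrt_mul (by positivity), Real.sqrt_sq hK]
      rw [hb']
      refine Real.le_sqrt_of_sq_le ?_
      rw [WithLp.prod_norm_sq_eq_of_L2]
      change ‖K • φ z‖ ^ 2 + ‖-(K * (y z / α))‖ ^ 2 ≤ _
      simp only [Real.norm_eq_abs, sq_abs, norm_smul, mul_pow, neg_sq, div_pow]
      have h1 := hφ z
      have h2 : (y z) ^ 2 ≤ cy ^ 2 := sq_le_sq' (neg_le_of_abs_le (hy z)) (le_of_abs_le (hy z))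
      rw [mul_add]
      gcongr
    · intro i z
      simp only [hinner, abs_mul, abs_of_nonneg hK]
      exact hl1 _ _
    · intro i j z
      simp only [hinner]
      rw [← mul_sub, abs_mul, abs_of_nonneg hK]
      simpa using hl2 (g i) (g j) z

end UniformDeviation

/-! ### Piecewise continuous signals -/

section PiecewiseContinuous

variable {X : Type*} [NormedAddCommGroup X] {f : ℝ → X} {a b : ℝ}

lemma PiecewiseContinuousOn.measurable_indicator [MeasurableSpace X] [BorelSpace X]
    (hf : PiecewiseContinuousOn f a b) : Measurable ((Icc a b).indicator f) := by
  obtain ⟨⟨F, hF⟩, -, -⟩ := hf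
  refine measurable_of_measurable_on_compl_finite (F ∪ {a, b} : Set ℝ) (by simp) ?_
  have : ContinuousOn ((Icc a b).indicator f) (F ∪ {a, b} : Set ℝ)ᶜ := by
    intro t ht
    simp only [compl_union, mem_inter_iff, mem_compl_iff, Finset.mem_coe, mem_insert_iff,
      mem_singleton_iff, not_or] at ht
    obtain ⟨htF, hta, htb⟩ := ht
    refine ContinuousAt.continuousWithinAt ?_
    by_cases h : t ∈ Icc a b
    · have hn : Icc a b ∈ 𝓝 t :=
        Icc_mem_nhds (lt_of_le_of_ne h.1 (Ne.symm hta)) (lt_of_le_of_ne h.2 htb)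
      refine ((hF t h htF).continuousAt hn).congr ?_
      filter_upwards [hn] with x hx
      rw [indicator_of_mem hx]
    · have hn : (Icc a b)ᶜ ∈ 𝓝 t := isClosed_Icc.isOpen_compl.mem_nhds h
      refine (continuousAt_const (y := (0 : X))).congr ?_
      filter_upwards [hn] with x hx
      rw [indicator_of_notMem hx]
  exact (continuousOn_iff_continuous_domRestrict.1 this).measurable

/-- The existence of one-sided limits bounds `f` near every point of `[a, b]`, apart from its value
at the point itself; compactness makes the bound global. Continuity off a finite set alone would not
exclude poles. -/
lemma PiecewiseContinuousOn.exists_norm_indicator_le (hf : PiecewiseContinuousOn f a b) :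
    ∃ M, ∀ t, ‖(Icc a b).indicator f t‖ ≤ M := by
  obtain ⟨-, hr, hl⟩ := hf
  have ev : ∀ {l : Filter ℝ} {x : X}, Tendsto f l (𝓝 x) → ∀ᶠ t in l, ‖f t‖ ≤ ‖x‖ + 1 :=
    fun h => (h.norm.eventually (gt_mem_nhds (lt_add_one _))).mono fun _ => le_of_lt
  have key : ∃ M, ∀ t ∈ Icc a b, ‖f t‖ ≤ M := by
    refine isCompact_Icc.induction_on (p := fun s => ∃ M, ∀ t ∈ s, ‖f t‖ ≤ M) ⟨0, by simp⟩
      (fun s s' hs ⟨M, hM⟩ => ⟨M, fun t ht => hM t (hs ht)⟩)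
      (fun s s' ⟨M, hM⟩ ⟨M', hM'⟩ => ⟨max M M', fun t ht => ?_⟩) fun t ht => ?_
    · exact ht.elim (fun h => (hM t h).trans (le_max_left _ _))
        (fun h => (hM' t h).trans (le_max_right _ _))
    · have h1 : ∃ M, ∀ᶠ x in 𝓝[>] t, x ∈ Icc a b → ‖f x‖ ≤ M := by
        rcases ht.2.eq_or_lt with h | h
        · refine ⟨0, ?_⟩
          filter_upwards [self_mem_nhdsWithin] with x hx hx'
          exact absurd hx'.2 (by rw [← h]; exact not_le.2 hx)
        · obtain ⟨x, hx⟩ := hr t ⟨ht.1, h⟩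
          exact ⟨_, (ev hx).mono fun _ h _ => h⟩
      have h2 : ∃ M, ∀ᶠ x in 𝓝[<] t, x ∈ Icc a b → ‖f x‖ ≤ M := by
        rcases ht.1.eq_or_lt with h | h
        · refine ⟨0, ?_⟩
          filter_upwards [self_mem_nhdsWithin] with x hx hx'
          exact absurd hx'.1 (by rw [h]; exact not_le.2 hx)
        · obtain ⟨x, hx⟩ := hl t ⟨h, ht.2⟩
          exact ⟨_, (ev hx).mono fun _ h _ => h⟩
      obtain ⟨M1, h1⟩ := h1
      obtain ⟨M2, h2⟩ := h2
      have h3 : ∀ᶠ x in 𝓝 t, x ≠ t → x ∈ Icc a b → ‖f x‖ ≤ max M1 M2 := by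
        refine eventually_nhdsWithin_iff (s := {t}ᶜ).1 ?_
        rw [← nhdsLT_sup_nhdsGT, eventually_sup]
        exact ⟨h2.mono fun x h hx => (h hx).trans (le_max_right _ _),
          h1.mono fun x h hx => (h hx).trans (le_max_left _ _)⟩
      refine ⟨{x | x ∈ Icc a b → ‖f x‖ ≤ max (max M1 M2) ‖f t‖} ∩ Icc a b, ?_,
        max (max M1 M2) ‖f t‖, fun x hx => hx.1 hx.2⟩
      refine inter_mem (mem_nhdsWithin_of_mem_nhds ?_) self_mem_nhdsWithin
      filter_upwards [h3] with x hx hxI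
      by_cases hxt : x = t
      · rw [hxt]; exact le_max_right _ _
      · exact (hx hxt hxI).trans (le_max_left _ _)
  obtain ⟨M, hM⟩ := key
  refine ⟨max M 0, fun t => ?_⟩
  by_cases h : t ∈ Icc a b
  · rw [indicator_of_mem h]; exact (hM t h).trans (le_max_left _ _)
  · rw [indicator_of_notMem h, norm_zero]; exact le_max_right _ _

end PiecewiseContinuous

/-! ### Integration over the time simplex -/

section Simplex

lemma isClosed_timeSimplex (k : ℕ) : IsClosed (timeSimplex k) := by
  have : timeSimplex k = {τ | ∀ i j, i ≤ j → τ i ≤ τ j} ∩ {τ | ∀ j, 0 ≤ τ j} := by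
    ext τ
    exact Iff.rfl
  rw [this]
  refine IsClosed.inter ?_ ?_
  · simp only [ofPred_forall]
    exact isClosed_iInter fun i => isClosed_iInter fun j => isClosed_iInter fun _ =>
      isClosed_le (continuous_apply i) (continuous_apply j)
  · simp only [ofPred_forall]
    exact isClosed_iInter fun i => isClosed_le continuous_const (continuous_apply i)

lemma measurableSet_timeSimplex (k : ℕ) : MeasurableSet (timeSimplex k) :=
  (isClosed_timeSimplex k).measurableSet

lemma mem_timeSimplex_one {τ : Fin 1 → ℝ} : τ ∈ timeSimplex 1 ↔ 0 ≤ τ 0 := by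
  refine ⟨fun h => h.2 0, fun h => ⟨fun i j _ => ?_, fun j => ?_⟩⟩
  · rw [Subsingleton.elim i j]
  · rwa [Subsingleton.elim j 0]

lemma snoc_mem_timeSimplex {k : ℕ} {τ : Fin (k + 1) → ℝ} {σ : ℝ} :
    (Fin.snoc τ σ : Fin (k + 2) → ℝ) ∈ timeSimplex (k + 2) ↔
      τ ∈ timeSimplex (k + 1) ∧ τ (Fin.last k) ≤ σ := by
  constructor
  · rintro ⟨h1, h2⟩
    refine ⟨⟨fun i j hij => ?_, fun j => ?_⟩, ?_⟩
    · simpa using h1 (Fin.castSucc_le_castSucc_iff.2 hij)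
    · simpa using h2 j.castSucc
    · simpa using h1 (Fin.le_last (Fin.last k).castSucc)
  · rintro ⟨⟨h1, h2⟩, h3⟩
    refine ⟨fun i j hij => ?_, fun j => ?_⟩
    · induction j using Fin.lastCases with
      | last =>
        induction i using Fin.lastCases with
        | last => exact le_rfl
        | cast i => simpa using (h1 (Fin.le_last i)).trans h3
      | cast j =>
        induction i using Fin.lastCases with
        | last => exact absurd hij (by simp [Fin.le_def]; omega)
        | cast i => simpa using h1 (Fin.castSucc_le_castSucc_iff.1 hij)
    · induction j using Fin.lastCases with
      | last => simpa using (h2 (Fin.last k)).trans h3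
      | cast j => simpa using h2 j

lemma measurePreserving_snoc (n : ℕ) :
    MeasurePreserving (fun q : (Fin n → ℝ) × ℝ => (Fin.snoc q.1 q.2 : Fin (n + 1) → ℝ)) := by
  have h1 := (volume_preserving_piFinSuccAbove (fun _ : Fin (n + 1) => ℝ) (Fin.last n)).symm
  have h2 := h1.comp (Measure.measurePreserving_swap (μ := (volume : Measure (Fin n → ℝ)))
    (ν := (volume : Measure ℝ)))
  convert h2 using 1
  · ext q i
    simp [MeasurableEquiv.piFinSuccAbove, Fin.insertNthEquiv, Fin.insertNth_last']
  · exact Measure.volume_eq_prod _ _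

/-- The volume preserving parametrization of the simplex in which the last time is replaced by its
reflected distance to the last but one. -/
lemma measurePreserving_snoc_shift (n : ℕ) (t : ℝ) :
    MeasurePreserving (fun q : (Fin (n + 1) → ℝ) × ℝ =>
      (Fin.snoc q.1 (q.1 (Fin.last n) + (t - q.2)) : Fin (n + 2) → ℝ)) := by
  have h1 : MeasurePreserving (fun q : (Fin (n + 1) → ℝ) × ℝ =>
      (q.1, q.1 (Fin.last n) + (t - q.2))) := by
    refine (MeasurePreserving.id volume).skew_product
      (g := fun (τ : Fin (n + 1) → ℝ) (s : ℝ) => τ (Fin.last n) + (t - s)) ?_ ?_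
    · change Measurable fun q : (Fin (n + 1) → ℝ) × ℝ => q.1 (Fin.last n) + (t - q.2)
      fun_prop
    · refine ae_of_all _ fun τ => ?_
      exact ((measurePreserving_add_left volume (τ (Fin.last n))).comp
        (Measure.measurePreserving_sub_left volume t)).map_eq
  exact (measurePreserving_snoc (n + 1)).comp h1

/-- The distribution of the last time of the simplex. -/
lemma lintegral_timeSimplex_last (k : ℕ) {g : ℝ → ℝ≥0∞} (hg : Measurable g) :
    ∫⁻ τ in timeSimplex (k + 1), g (τ (Fin.last k)) =
      ∫⁻ t in Ici (0 : ℝ), g t * ENNReal.ofReal (t ^ k / k.factorial) := by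
  induction k generalizing g with
  | zero =>
    have mp := volume_preserving_funUnique (Fin 1) ℝ
    rw [← lintegral_indicator (measurableSet_timeSimplex _), ← lintegral_indicator measurableSet_Ici,
      ← mp.lintegral_comp]
    · refine lintegral_congr fun τ => ?_
      have h0 : τ ∈ timeSimplex (0 + 1) ↔ 0 ≤ τ 0 := mem_timeSimplex_one
      simp [indicator, h0]
    · exact Measurable.indicator (by fun_prop) measurableSet_Ici
  | succ k ih =>
    have hm : Measurable fun τ : Fin (k + 2) → ℝ => g (τ (Fin.last (k + 1))) := by fun_prop
    have hJ : Measurable fun s : ℝ => ∫⁻ t in Ici s, g t := by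
      have : (fun s : ℝ => ∫⁻ t in Ici s, g t) =
          fun s => ∫⁻ t, {q : ℝ × ℝ | q.1 ≤ q.2}.indicator (fun q => g q.2) (s, t) := by
        ext s
        rw [← lintegral_indicator measurableSet_Ici]
        rfl
      rw [this]
      refine Measurable.lintegral_prod_right' (f := {q : ℝ × ℝ | q.1 ≤ q.2}.indicator fun q => g q.2)
        (Measurable.indicator (by fun_prop) (measurableSet_le measurable_fst measurable_snd))
    -- Integrating out the last time leaves a function of the last but one, to which the induction
    -- hypothesis applies. Tonelli's theorem and `∫ s in 0..t, s ^ k / k! = t ^ (k + 1) / (k + 1)!`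
    -- then give the density.
    have h1 : ∫⁻ τ in timeSimplex (k + 2), g (τ (Fin.last (k + 1))) =
        ∫⁻ τ in timeSimplex (k + 1), ∫⁻ t in Ici (τ (Fin.last k)), g t := by
      rw [← lintegral_indicator (measurableSet_timeSimplex _),
        ← (measurePreserving_snoc (k + 1)).lintegral_comp
          (hm.indicator (measurableSet_timeSimplex _)), Measure.volume_eq_prod, lintegral_prod,
        ← lintegral_indicator (measurableSet_timeSimplex _)]
      · refine lintegral_congr fun τ => ?_
        by_cases h : τ ∈ timeSimplex (k + 1)
        · rw [indicator_of_mem h, ← lintegral_indicator measurableSet_Ici]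
          refine lintegral_congr fun t => ?_
          simp [indicator, snoc_mem_timeSimplex, h]
        · rw [indicator_of_notMem h]
          simp [indicator, snoc_mem_timeSimplex, h]
      · exact ((hm.indicator (measurableSet_timeSimplex _)).comp
          (measurePreserving_snoc (k + 1)).measurable).aemeasurable
    rw [h1, ih hJ]
    have hm2 : Measurable fun q : ℝ × ℝ => {q : ℝ × ℝ | 0 ≤ q.1 ∧ q.1 ≤ q.2}.indicator
        (fun q => g q.2 * ENNReal.ofReal (q.1 ^ k / k.factorial)) q :=
      Measurable.indicator (by fun_prop) ((measurableSet_le measurable_const measurable_fst).inter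
        (measurableSet_le measurable_fst measurable_snd))
    calc ∫⁻ s in Ici (0 : ℝ), (∫⁻ t in Ici s, g t) * ENNReal.ofReal (s ^ k / k.factorial)
        = ∫⁻ s, ∫⁻ t, {q : ℝ × ℝ | 0 ≤ q.1 ∧ q.1 ≤ q.2}.indicator
            (fun q => g q.2 * ENNReal.ofReal (q.1 ^ k / k.factorial)) (s, t) := by
          rw [← lintegral_indicator measurableSet_Ici]
          refine lintegral_congr fun s => ?_
          by_cases hs : 0 ≤ s
          · rw [indicator_of_mem (by exact hs), ← lintegral_mul_const _ hg,
              ← lintegral_indicator measurableSet_Ici]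
            refine lintegral_congr fun t => ?_
            simp [indicator, hs]
          · rw [indicator_of_notMem (by exact hs)]
            simp [indicator, hs]
      _ = ∫⁻ t, ∫⁻ s, {q : ℝ × ℝ | 0 ≤ q.1 ∧ q.1 ≤ q.2}.indicator
            (fun q => g q.2 * ENNReal.ofReal (q.1 ^ k / k.factorial)) (s, t) :=
          lintegral_lintegral_swap hm2.aemeasurable
      _ = _ := by
          rw [← lintegral_indicator measurableSet_Ici]
          refine lintegral_congr fun t => ?_
          have e : ∀ s, {q : ℝ × ℝ | 0 ≤ q.1 ∧ q.1 ≤ q.2}.indicator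
              (fun q => g q.2 * ENNReal.ofReal (q.1 ^ k / k.factorial)) (s, t) =
              (Icc 0 t).indicator (fun s => g t * ENNReal.ofReal (s ^ k / k.factorial)) s := by
            intro s
            simp [indicator]
          simp_rw [e]
          rw [lintegral_indicator measurableSet_Icc, lintegral_const_mul _ (by fun_prop)]
          by_cases ht : 0 ≤ t
          · rw [indicator_of_mem (by exact ht), ← ofReal_integral_eq_lintegral_ofReal]
            · congr 2
              rw [integral_Icc_eq_integral_Ioc, ← intervalIntegral.integral_of_le ht,
                intervalIntegral.integral_div, integral_pow, Nat.factorial_succ]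
              push_cast
              field_simp
              simp
            · exact (Continuous.integrableOn_Icc (by fun_prop))
            · refine (ae_restrict_mem measurableSet_Icc).mono fun s hs => ?_
              have := hs.1
              simp only [Pi.zero_apply]
              positivity
          · rw [indicator_of_notMem (by exact ht), Icc_eq_empty ht]
            simp

end Simplex

/-! ### Volterra kernels of the state -/

namespace LPVSystem

open scoped Matrix.Norms.Operator

variable {np nin : ℕ} (G : LPVSystem np nin)

lemma _root_.affineMatrix_eq_sum {a b : ℕ} (M : Fin (np + 1) → Matrix (Fin a) (Fin b) ℝ)
    (q : Fin np → ℝ) :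
    affineMatrix M q = ∑ i, (Fin.cons 1 q : Fin (np + 1) → ℝ) i • M i := by
  rw [Fin.sum_univ_succ]
  simp [affineMatrix]

/-- The part `∑_{i ≥ 1} q_i A_i` of `A(q)` that depends on the scheduling variable. -/
noncomputable def schedMatrix (q : Fin np → ℝ) : Matrix (Fin G.nx) (Fin G.nx) ℝ :=
  ∑ i, q i • G.A i.succ

/-- The matrix exponential `e^{A_0 t}`. -/
noncomputable def flow (t : ℝ) : Matrix (Fin G.nx) (Fin G.nx) ℝ := NormedSpace.exp (t • G.A 0)

/-- The product of scheduling signals that multiplies the input in the Volterra series, at time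
`t`. -/
noncomputable def schedWeight (p : ℝ → Fin np → ℝ) (ir : Fin (np + 1)) {k : ℕ}
    (I : Fin k → Fin np) (t : ℝ) (τ : Fin (k + 1) → ℝ) : ℝ :=
  (Fin.cons 1 (p (t - τ (Fin.last k))) : Fin (np + 1) → ℝ) ir *
    ∏ j, p (t - τ (Fin.last k) + τ j.castSucc) (I j)

/-- The integrand of the `k`-th term of the Volterra series of the state at time `t`. -/
noncomputable def stateKernel (p : ℝ → Fin np → ℝ) (u : ℝ → Fin nin → ℝ) (k : ℕ) (t : ℝ)
    (τ : Fin (k + 1) → ℝ) : Fin G.nx → ℝ :=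
  ∑ I : Fin k → Fin np, ∑ ir, schedWeight p ir I t τ •
    (G.inputKernel ir k I τ *ᵥ u (t - τ (Fin.last k)))

/-- The `k`-th term of the Volterra series of the state. -/
noncomputable def stateTerm (p : ℝ → Fin np → ℝ) (u : ℝ → Fin nin → ℝ) (k : ℕ) (t : ℝ) :
    Fin G.nx → ℝ :=
  ∫ τ in timeSimplex (k + 1), G.stateKernel p u k t τ

lemma continuous_flow : Continuous G.flow := by
  have : Continuous fun t : ℝ => t • G.A 0 := by fun_prop
  exact (NormedSpace.exp_continuous (𝔸 := Matrix (Fin G.nx) (Fin G.nx) ℝ)).comp this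

lemma flow_zero : G.flow 0 = 1 := by simp [flow, NormedSpace.exp_zero]

lemma flow_add (s t : ℝ) : G.flow (s + t) = G.flow s * G.flow t := by
  rw [flow, add_smul]
  exact NormedSpace.exp_add_of_commute (((Commute.refl (G.A 0)).smul_left s).smul_right t)

lemma hasDerivAt_flow (t : ℝ) : HasDerivAt G.flow (G.A 0 * G.flow t) t :=
  hasDerivAt_exp_smul_const' (G.A 0) t

lemma continuous_inputKernel (ir : Fin (np + 1)) (k : ℕ) (I : Fin k → Fin np) :
    Continuous fun τ => G.inputKernel ir k I τ := by
  induction k with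
  | zero =>
    simp only [inputKernel]
    exact Continuous.matrix_mul (G.continuous_flow.comp (continuous_apply 0)) continuous_const
  | succ k ih =>
    simp only [inputKernel]
    refine Continuous.matrix_mul (Continuous.matrix_mul (G.continuous_flow.comp
      (g := G.flow) (f := fun τ : Fin (k + 2) → ℝ => τ (Fin.last (k + 1)) - τ (Fin.last k).castSucc)
      (by fun_prop)) continuous_const) ((ih _).comp ?_)
    exact continuous_pi fun i => continuous_apply _

lemma _root_.measurable_matrix_mulVec {α m n : Type*} [MeasurableSpace α] [Fintype n]
    {M : α → Matrix m n ℝ} {v : α → n → ℝ} (hM : ∀ i j, Measurable fun x => M x i j)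
    (hv : Measurable v) : Measurable fun x => M x *ᵥ v x := by
  refine measurable_pi_iff.2 fun i => ?_
  simp only [Matrix.mulVec, dotProduct]
  have := fun j => hM i j
  fun_prop

variable {p : ℝ → Fin np → ℝ} {u : ℝ → Fin nin → ℝ}

lemma measurable_schedWeight (hp : Measurable p) (ir : Fin (np + 1)) {k : ℕ} (I : Fin k → Fin np) :
    Measurable fun q : ℝ × (Fin (k + 1) → ℝ) => schedWeight p ir I q.1 q.2 := by
  unfold schedWeight
  refine Measurable.mul ?_ (Finset.measurable_fun_prod _ fun j _ => ?_)
  · cases ir using Fin.cases with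
    | zero => simp
    | succ i =>
      simp only [Fin.cons_succ]
      exact (measurable_pi_apply i).comp (hp.comp (by fun_prop))
  · exact (measurable_pi_apply _).comp (hp.comp (by fun_prop))

lemma measurable_stateKernel (hp : Measurable p) (hu : Measurable u) (k : ℕ) :
    Measurable fun q : ℝ × (Fin (k + 1) → ℝ) => G.stateKernel p u k q.1 q.2 := by
  unfold stateKernel
  refine Finset.measurable_fun_sum _ fun I _ => Finset.measurable_fun_sum _ fun ir _ => ?_
  refine (measurable_schedWeight hp ir I).smul (measurable_matrix_mulVec (fun i j => ?_)
    (hu.comp (by fun_prop)))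
  exact ((G.continuous_inputKernel ir k I).matrix_elem i j).measurable.comp measurable_snd

lemma measurable_stateTerm (hp : Measurable p) (hu : Measurable u) (k : ℕ) :
    Measurable (G.stateTerm p u k) := by
  have := (G.measurable_stateKernel hp hu k).stronglyMeasurable.integral_prod_right'
    (ν := volume.restrict (timeSimplex (k + 1)))
  exact this.measurable

lemma stateKernel_zero (t : ℝ) (τ : Fin 1 → ℝ) :
    G.stateKernel p u 0 t τ =
      G.flow (τ 0) *ᵥ (affineMatrix G.B (p (t - τ 0)) *ᵥ u (t - τ 0)) := by
  rw [affineMatrix_eq_sum]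
  simp only [stateKernel, schedWeight, inputKernel, Finset.univ_unique, Finset.sum_singleton,
    Finset.univ_eq_empty, Finset.prod_empty, mul_one, Matrix.sum_mulVec, Matrix.mulVec_sum,
    Matrix.smul_mulVec, Matrix.mulVec_smul, Matrix.mulVec_mulVec]
  rfl

/-- The times `τ` are elapsed times counted from the moment the input acts, so the last one is the
total delay. Here `s` is the absolute time at which the last factor `A_i` acts: up to `s` the kernel
of order `k` is at work, and afterwards the free flow over `t - s`. This is the recursion of Picard
iteration at the level of integrands. -/
lemma stateKernel_succ (k : ℕ) (t s : ℝ) (τ : Fin (k + 1) → ℝ) :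
    G.stateKernel p u (k + 1) t (Fin.snoc τ (τ (Fin.last k) + (t - s))) =
      G.flow (t - s) *ᵥ (G.schedMatrix (p s) *ᵥ G.stateKernel p u k s τ) := by
  have e1 : t - (τ (Fin.last k) + (t - s)) = s - τ (Fin.last k) := by ring
  have e2 : τ (Fin.last k) + (t - s) - τ (Fin.last k) = t - s := by ring
  have e3 : s - τ (Fin.last k) + τ (Fin.last k) = s := by ring
  have e4 : ∀ x, G.schedMatrix (p s) *ᵥ x = ∑ i, p s i • (G.A i.succ *ᵥ x) := fun x => by
    rw [schedMatrix, Matrix.sum_mulVec]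
    simp only [Matrix.smul_mulVec]
  rw [e4]
  simp only [stateKernel, Matrix.mulVec_sum, Matrix.mulVec_smul]
  simp only [Matrix.mulVec_mulVec]
  -- A multi-index of length `k + 1` is split into its last letter, which the sum in `schedMatrix`
  -- supplies, and the remaining `k` letters.
  rw [← (Fin.snocEquiv fun _ : Fin (k + 1) => Fin np).sum_comp (M := Fin G.nx → ℝ), Fintype.sum_prod_type]
  refine Finset.sum_congr rfl fun i _ => ?_
  simp only [Finset.smul_sum]
  refine Finset.sum_congr rfl fun I _ => Finset.sum_congr rfl fun ir _ => ?_
  rw [smul_smul]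
  congr 1
  · simp only [schedWeight, Fin.snocEquiv_apply, Fin.snoc_last, Fin.snoc_castSucc,
      Fin.prod_univ_castSucc, e1]
    rw [e3]
    ring
  · have e5 : Fin.init ((Fin.snocEquiv fun _ : Fin (k + 1) => Fin np) (i, I)) = I := by
      ext j
      simp [Fin.init]
    simp only [inputKernel, Fin.snocEquiv_apply, Fin.snoc_last, Fin.snoc_castSucc, e1, e2,
      Fin.init_snoc]
    rw [← Matrix.mul_assoc]
    erw [e5]
    rfl

lemma measurable_stateKernel_right (hp : Measurable p) (hu : Measurable u) (k : ℕ) (t : ℝ) :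
    Measurable fun τ : Fin (k + 1) → ℝ => G.stateKernel p u k t τ :=
  Measurable.of_uncurry_left (f := fun t τ => G.stateKernel p u k t τ)
    (G.measurable_stateKernel hp hu k)

/-- Causality: inputs that vanish before time 0 effectively truncate the unbounded simplex to total
delay at most `t`, which makes the integrals finite. -/
lemma stateKernel_eq_zero (hu0 : ∀ t < 0, u t = 0) {k : ℕ} {t : ℝ} {τ : Fin (k + 1) → ℝ}
    (h : t < τ (Fin.last k)) : G.stateKernel p u k t τ = 0 := by
  simp [stateKernel, hu0 (t - τ (Fin.last k)) (by linarith)]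

attribute [irreducible] stateKernel flow schedMatrix

end LPVSystem

/-- A bounded function that vanishes outside a set of finite measure is integrable. -/
lemma integrable_of_bounded_of_support {α F : Type*} [MeasurableSpace α] [NormedAddCommGroup F]
    {μ : Measure α} {f : α → F} (hf : AEStronglyMeasurable f μ) {s : Set α} (hs : μ s ≠ ∞)
    {M : ℝ} (hM : ∀ x, ‖f x‖ ≤ M) (h0 : ∀ x ∉ s, f x = 0) : Integrable f μ :=
  (Measure.integrableOn_of_bounded hs hf (ae_of_all _ hM)).integrable_of_forall_notMem_eq_zero h0

/-! ### Recursion for the terms of the Volterra series -/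

namespace LPVSystem

open scoped Matrix.Norms.Operator

variable {np nin : ℕ} (G : LPVSystem np nin) {p : ℝ → Fin np → ℝ} {u : ℝ → Fin nin → ℝ}

lemma stateTerm_eq_zero (hu0 : ∀ t < 0, u t = 0) {k : ℕ} {t : ℝ} (ht : t < 0) :
    G.stateTerm p u k t = 0 := by
  rw [stateTerm]
  refine (setIntegral_congr_fun (measurableSet_timeSimplex _) fun τ hτ => ?_).trans
    (integral_zero _ _)
  exact G.stateKernel_eq_zero hu0 (ht.trans_le (hτ.2 _))

lemma exists_norm_flow_le (T : ℝ) : ∃ E, 0 ≤ E ∧ ∀ t ∈ Icc 0 T, ‖G.flow t‖ ≤ E := by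
  obtain ⟨E, hE⟩ := isCompact_Icc.exists_bound_of_continuousOn
    (G.continuous_flow.continuousOn (s := Icc 0 T))
  exact ⟨max E 0, le_max_right _ _, fun t ht => (hE t ht).trans (le_max_left _ _)⟩

lemma norm_schedMatrix_le {q : Fin np → ℝ} (hq : ∀ i, |q i| ≤ 1) :
    ‖G.schedMatrix q‖ ≤ ∑ i : Fin np, ‖G.A i.succ‖ := by
  rw [schedMatrix]
  refine (norm_sum_le _ _).trans (Finset.sum_le_sum fun i _ => ?_)
  rw [norm_smul]
  exact mul_le_of_le_one_left (norm_nonneg _) (hq i)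

lemma norm_affineMatrix_le {a b : ℕ} (M : Fin (np + 1) → Matrix (Fin a) (Fin b) ℝ)
    {q : Fin np → ℝ} (hq : ∀ i, |q i| ≤ 1) : ‖affineMatrix M q‖ ≤ ∑ i, ‖M i‖ := by
  rw [affineMatrix_eq_sum]
  refine (norm_sum_le _ _).trans (Finset.sum_le_sum fun i _ => ?_)
  rw [norm_smul]
  refine mul_le_of_le_one_left (norm_nonneg _) ?_
  cases i using Fin.cases with
  | zero => simp
  | succ i => simpa using hq i

lemma norm_flow_mulVec_le {E C : ℝ} {n : ℕ} {t : ℝ} (hE : ‖G.flow t‖ ≤ E)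
    {M : Matrix (Fin G.nx) (Fin n) ℝ} (hM : ‖M‖ ≤ C) (v : Fin n → ℝ) :
    ‖G.flow t *ᵥ (M *ᵥ v)‖ ≤ E * C * ‖v‖ := by
  have hE0 := (norm_nonneg _).trans hE
  calc _ ≤ ‖G.flow t‖ * ‖M *ᵥ v‖ := Matrix.linfty_opNorm_mulVec _ _
    _ ≤ E * (C * ‖v‖) := by
        gcongr
        exact (Matrix.linfty_opNorm_mulVec _ _).trans (by gcongr)
    _ = _ := by ring

lemma exists_norm_stateKernel_le (hp1 : ∀ t i, |p t i| ≤ 1) {U : ℝ} (hU : ∀ t, ‖u t‖ ≤ U)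
    (hu0 : ∀ t < 0, u t = 0) (T : ℝ) (k : ℕ) :
    ∃ M, 0 ≤ M ∧ ∀ t ≤ T, ∀ τ ∈ timeSimplex (k + 1), ‖G.stateKernel p u k t τ‖ ≤ M := by
  obtain ⟨E, hE0, hE⟩ := G.exists_norm_flow_le T
  have hU0 : 0 ≤ U := (norm_nonneg _).trans (hU 0)
  induction k with
  | zero =>
    refine ⟨E * (∑ i, ‖G.B i‖) * U, by positivity, fun t ht τ hτ => ?_⟩
    rcases lt_or_ge t (τ (Fin.last 0)) with h | h
    · rw [G.stateKernel_eq_zero hu0 h, norm_zero]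
      positivity
    · rw [stateKernel_zero]
      refine (G.norm_flow_mulVec_le (hE _ ⟨hτ.2 0, h.trans ht⟩)
        (norm_affineMatrix_le G.B (hp1 _)) _).trans ?_
      gcongr
      exact hU _
  | succ k ih =>
    obtain ⟨M, hM0, hM⟩ := ih
    refine ⟨E * (∑ i : Fin np, ‖G.A i.succ‖) * M, by positivity, fun t ht τ hτ => ?_⟩
    rcases lt_or_ge t (τ (Fin.last (k + 1))) with h | h
    · rw [G.stateKernel_eq_zero hu0 h, norm_zero]
      positivity
    · set τ' : Fin (k + 1) → ℝ := Fin.init τ with hτ'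
      set s := t - τ (Fin.last (k + 1)) + τ' (Fin.last k) with hs
      have e : τ = Fin.snoc τ' (τ' (Fin.last k) + (t - s)) := by
        rw [show τ' (Fin.last k) + (t - s) = τ (Fin.last (k + 1)) by rw [hs]; ring, hτ',
          Fin.snoc_init_self]
      have hτ2 := hτ
      rw [e, snoc_mem_timeSimplex] at hτ2
      have h0 := hτ2.1.2 (Fin.last k)
      have hst : 0 ≤ t - s := by linarith [hτ2.2]
      rw [e, stateKernel_succ]
      refine (G.norm_flow_mulVec_le (hE _ ⟨hst, ?_⟩) (G.norm_schedMatrix_le (hp1 _)) _).trans ?_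
      · rw [hs]; linarith
      · gcongr
        exact hM s (by linarith) τ' hτ2.1

lemma volume_Icc_pi_ne_top (n : ℕ) (t : ℝ) :
    volume (Icc (0 : Fin n → ℝ) fun _ => t) ≠ ∞ := isCompact_Icc.measure_lt_top.ne

lemma mem_Icc_of_mem_timeSimplex {k : ℕ} {τ : Fin (k + 1) → ℝ} (hτ : τ ∈ timeSimplex (k + 1))
    {t : ℝ} (h : τ (Fin.last k) ≤ t) : τ ∈ Icc (0 : Fin (k + 1) → ℝ) fun _ => t :=
  ⟨fun j => hτ.2 j, fun j => (hτ.1 (Fin.le_last j)).trans h⟩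

lemma integrableOn_stateKernel (hp : Measurable p) (hu : Measurable u)
    (hp1 : ∀ t i, |p t i| ≤ 1) {U : ℝ} (hU : ∀ t, ‖u t‖ ≤ U) (hu0 : ∀ t < 0, u t = 0) (k : ℕ)
    (t : ℝ) : IntegrableOn (G.stateKernel p u k t) (timeSimplex (k + 1)) := by
  obtain ⟨M, hM0, hM⟩ := G.exists_norm_stateKernel_le hp1 hU hu0 t k
  have hm := G.measurable_stateKernel_right hp hu k t
  rw [← integrable_indicator_iff (measurableSet_timeSimplex _)]
  refine integrable_of_bounded_of_support (M := M)
    (hm.indicator (measurableSet_timeSimplex _)).aestronglyMeasurable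
    (volume_Icc_pi_ne_top (k + 1) t) (fun τ => ?_) fun τ hτ => ?_
  · by_cases h : τ ∈ timeSimplex (k + 1)
    · rw [indicator_of_mem h]; exact hM t le_rfl τ h
    · rw [indicator_of_notMem h, norm_zero]; exact hM0
  · by_cases h : τ ∈ timeSimplex (k + 1)
    · rw [indicator_of_mem h]
      refine G.stateKernel_eq_zero hu0 (not_le.1 fun h' => hτ (mem_Icc_of_mem_timeSimplex h h'))
    · rw [indicator_of_notMem h]

lemma measurable_schedMatrix (hp : Measurable p) (i j : Fin G.nx) :
    Measurable fun s => G.schedMatrix (p s) i j := by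
  simp only [schedMatrix, Matrix.sum_apply, Matrix.smul_apply]
  have := fun i => (measurable_pi_apply i).comp hp
  simp only [Function.comp_def] at this
  fun_prop

lemma measurable_affineMatrix {a b : ℕ} (M : Fin (np + 1) → Matrix (Fin a) (Fin b) ℝ)
    (hp : Measurable p) (i : Fin a) (j : Fin b) :
    Measurable fun s => affineMatrix M (p s) i j := by
  simp only [affineMatrix, Matrix.add_apply, Matrix.sum_apply, Matrix.smul_apply]
  have := fun i => (measurable_pi_apply i).comp hp
  simp only [Function.comp_def] at this
  fun_prop

lemma stateTerm_zero (hu0 : ∀ t < 0, u t = 0) {t : ℝ} (ht : 0 ≤ t) :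
    G.stateTerm p u 0 t =
      ∫ s in (0 : ℝ)..t, G.flow (t - s) *ᵥ (affineMatrix G.B (p s) *ᵥ u s) := by
  have h1 : G.stateTerm p u 0 t =
      ∫ σ : ℝ, (Ici 0).indicator
        (fun σ => G.flow σ *ᵥ (affineMatrix G.B (p (t - σ)) *ᵥ u (t - σ))) σ := by
    rw [stateTerm, ← integral_indicator (measurableSet_timeSimplex _),
      ← (volume_preserving_funUnique (Fin 1) ℝ).integral_comp']
    refine integral_congr_ae (ae_of_all _ fun τ => ?_)
    have h0 : τ ∈ timeSimplex (0 + 1) ↔ 0 ≤ τ 0 := mem_timeSimplex_one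
    simp [indicator, h0, stateKernel_zero]
  rw [h1, ← integral_sub_left_eq_self _ volume t, intervalIntegral.integral_of_le ht,
    ← integral_Icc_eq_integral_Ioc, ← integral_indicator measurableSet_Icc]
  refine integral_congr_ae (ae_of_all _ fun s => ?_)
  by_cases hs : s < 0
  · have : s ∉ Icc 0 t := fun h => absurd h.1 (not_le.2 hs)
    simp [indicator, this, hu0 s hs]
  · simp [indicator, not_lt.1 hs]

/-- The kernel recursion integrated by Fubini in the coordinates of `measurePreserving_snoc_shift`.
Each term arises from the previous one by treating `schedMatrix (p s)` as a perturbation of the flow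
of `A_0`. -/
lemma stateTerm_succ (hp : Measurable p) (hu : Measurable u)
    (hp1 : ∀ t i, |p t i| ≤ 1) {U : ℝ} (hU : ∀ t, ‖u t‖ ≤ U) (hu0 : ∀ t < 0, u t = 0) (k : ℕ)
    {t : ℝ} (ht : 0 ≤ t) :
    G.stateTerm p u (k + 1) t =
      ∫ s in (0 : ℝ)..t, G.flow (t - s) *ᵥ (G.schedMatrix (p s) *ᵥ G.stateTerm p u k s) := by
  set F : (Fin (k + 1) → ℝ) × ℝ → Fin G.nx → ℝ :=
    (timeSimplex (k + 1) ×ˢ Icc 0 t).indicator fun q =>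
      G.flow (t - q.2) *ᵥ (G.schedMatrix (p q.2) *ᵥ G.stateKernel p u k q.2 q.1) with hF
  have hFm : Measurable F := by
    refine Measurable.indicator ?_ ((measurableSet_timeSimplex _).prod measurableSet_Icc)
    refine measurable_matrix_mulVec (fun i j => ?_) (measurable_matrix_mulVec (fun i j => ?_) ?_)
    · exact ((G.continuous_flow.matrix_elem i j).comp (by fun_prop)).measurable
    · exact (G.measurable_schedMatrix hp i j).comp measurable_snd
    · have h1 := G.measurable_stateKernel hp hu k
      have h2 : Measurable fun q : (Fin (k + 1) → ℝ) × ℝ => (q.2, q.1) := measurable_swap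
      have h3 := h1.comp h2
      simp only [Function.comp_def] at h3
      exact h3
  have hFi : Integrable F (volume.prod volume) := by
    obtain ⟨M, hM0, hM⟩ := G.exists_norm_stateKernel_le hp1 hU hu0 t k
    obtain ⟨E, hE0, hE⟩ := G.exists_norm_flow_le t
    refine integrable_of_bounded_of_support (M := E * (∑ i : Fin np, ‖G.A i.succ‖) * M)
      hFm.aestronglyMeasurable (s := (Icc (0 : Fin (k + 1) → ℝ) fun _ => t) ×ˢ Icc 0 t)
      ?_ (fun q => ?_) fun q hq => ?_
    · rw [Measure.prod_prod]
      exact ENNReal.mul_ne_top (volume_Icc_pi_ne_top _ _) isCompact_Icc.measure_lt_top.ne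
    · by_cases h : q ∈ timeSimplex (k + 1) ×ˢ Icc 0 t
      · rw [hF, indicator_of_mem h]
        refine (G.norm_flow_mulVec_le (hE _ ⟨by linarith [h.2.2], by linarith [h.2.1]⟩)
          (G.norm_schedMatrix_le (hp1 _)) _).trans ?_
        gcongr
        exact hM _ h.2.2 _ h.1
      · rw [hF, indicator_of_notMem h, norm_zero]
        positivity
    · by_cases h : q ∈ timeSimplex (k + 1) ×ˢ Icc 0 t
      · rw [hF, indicator_of_mem h, G.stateKernel_eq_zero hu0, Matrix.mulVec_zero,
          Matrix.mulVec_zero]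
        refine not_le.1 fun h' => hq ⟨mem_Icc_of_mem_timeSimplex h.1 (h'.trans h.2.2), h.2⟩
      · rw [hF, indicator_of_notMem h]
  have hm := G.measurable_stateKernel_right hp hu (k + 1) t
  have h1 : G.stateTerm p u (k + 1) t = ∫ q, F q ∂(volume.prod volume) := by
    have mp := measurePreserving_snoc_shift k t
    rw [stateTerm, ← integral_indicator (measurableSet_timeSimplex _), ← mp.map_eq,
      integral_map mp.measurable.aemeasurable
        (hm.indicator (measurableSet_timeSimplex _)).aestronglyMeasurable, Measure.volume_eq_prod]
    refine integral_congr_ae (ae_of_all _ fun q => ?_)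
    obtain ⟨τ, s⟩ := q
    have hmem : (Fin.snoc τ (τ (Fin.last k) + (t - s)) : Fin (k + 2) → ℝ) ∈
        timeSimplex (k + 1 + 1) ↔ τ ∈ timeSimplex (k + 1) ∧ s ≤ t :=
      snoc_mem_timeSimplex.trans (by rw [le_add_iff_nonneg_right, sub_nonneg])
    change (timeSimplex (k + 1 + 1)).indicator (G.stateKernel p u (k + 1) t)
      (Fin.snoc τ (τ (Fin.last k) + (t - s))) = F (τ, s)
    by_cases h : τ ∈ timeSimplex (k + 1) ∧ s ≤ t
    · rw [indicator_of_mem (hmem.2 h), stateKernel_succ]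
      -- The simplex constraint only gives `s ≤ t`; for `s < 0` the kernel vanishes by causality, so
      -- `F` may carry the extra condition `0 ≤ s`.
      by_cases hs : 0 ≤ s
      · rw [hF, indicator_of_mem (show (τ, s) ∈ timeSimplex (k + 1) ×ˢ Icc 0 t from ⟨h.1, hs, h.2⟩)]
      · rw [hF, indicator_of_notMem (fun h' => hs h'.2.1),
          G.stateKernel_eq_zero hu0 ((not_le.1 hs).trans_le (h.1.2 _)), Matrix.mulVec_zero,
          Matrix.mulVec_zero]
    · rw [indicator_of_notMem (mt hmem.1 h), hF,
        indicator_of_notMem (fun h' => h ⟨h'.1, h'.2.2⟩)]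
  rw [h1, integral_prod_symm _ hFi, intervalIntegral.integral_of_le ht,
    ← integral_Icc_eq_integral_Ioc, ← integral_indicator measurableSet_Icc]
  refine integral_congr_ae (ae_of_all _ fun s => ?_)
  by_cases hs : s ∈ Icc 0 t
  · simp only [hF]
    rw [indicator_of_mem hs, stateTerm, Matrix.mulVec_mulVec]
    have := (LinearMap.toContinuousLinearMap
      (Matrix.mulVecLin (G.flow (t - s) * G.schedMatrix (p s)))).integral_comp_comm
      (G.integrableOn_stateKernel hp hu hp1 hU hu0 k s)
    simp only [LinearMap.coe_toContinuousLinearMap', Matrix.mulVecLin_apply] at this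
    rw [← this, ← integral_indicator (measurableSet_timeSimplex _)]
    refine integral_congr_ae (ae_of_all _ fun τ => ?_)
    by_cases hτ : τ ∈ timeSimplex (k + 1)
    · simp only [indicator, mem_prod, hs, hτ, and_self, if_true, Matrix.mulVec_mulVec]
    · simp only [indicator, mem_prod, hτ, false_and, if_false]
  · simp [hF, indicator, mem_prod, hs]

end LPVSystem

/-! ### Convergence of the Volterra series and existence of the trajectory -/

/-- One step of Picard iteration. It serves both the convergence of the series and the uniqueness of
the trajectory. -/
lemma norm_integral_le_pow_succ_div_factorial {F : Type*} [NormedAddCommGroup F] [NormedSpace ℝ F]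
    {f : ℝ → F} {K C : ℝ} {k : ℕ} {t : ℝ} (ht : 0 ≤ t)
    (h : ∀ s ∈ Ioc 0 t, ‖f s‖ ≤ C * (K * ((C * s) ^ k / k.factorial))) :
    ‖∫ s in (0 : ℝ)..t, f s‖ ≤ K * ((C * t) ^ (k + 1) / (k + 1).factorial) := by
  refine (intervalIntegral.norm_integral_le_of_norm_le ht (ae_of_all _ h)
    (Continuous.intervalIntegrable (by fun_prop) _ _)).trans_eq ?_
  simp only [mul_pow, intervalIntegral.integral_const_mul, intervalIntegral.integral_div,
    integral_pow, Nat.factorial_succ]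
  push_cast
  field_simp
  simp
  ring

namespace LPVSystem

open scoped Matrix.Norms.Operator

lemma isBoundedBilinearMap_mulVec (m n : ℕ) :
    IsBoundedBilinearMap ℝ fun q : Matrix (Fin m) (Fin n) ℝ × (Fin n → ℝ) => q.1 *ᵥ q.2 where
  add_left x y z := Matrix.add_mulVec x y z
  smul_left c x y := Matrix.smul_mulVec c x y
  add_right x y z := Matrix.mulVec_add x y z
  smul_right c x y := Matrix.mulVec_smul x c y
  bound := ⟨1, one_pos, fun x y => by rw [one_mul]; exact Matrix.linfty_opNorm_mulVec x y⟩

variable {np nin : ℕ} (G : LPVSystem np nin) {p : ℝ → Fin np → ℝ} {u : ℝ → Fin nin → ℝ} {U : ℝ}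

lemma affineMatrix_A_eq (q : Fin np → ℝ) : affineMatrix G.A q = G.A 0 + G.schedMatrix q := by
  rw [schedMatrix]; rfl

/-- The factorial, gained by iterating the integral recursion, gives summability and a majorant
uniform on `[0, T]`. -/
lemma exists_norm_stateTerm_le
    (hp : Measurable p) (hu : Measurable u) (hp1 : ∀ t i, |p t i| ≤ 1)
    (hU : ∀ t, ‖u t‖ ≤ U) (hu0 : ∀ t < 0, u t = 0) (T : ℝ) : ∃ M C : ℝ, 0 ≤ M ∧ 0 ≤ C ∧
    ∀ k, ∀ t ∈ Icc 0 T, ‖G.stateTerm p u k t‖ ≤ M * ((C * t) ^ k / k.factorial) := by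
  obtain ⟨E, hE0, hE⟩ := G.exists_norm_flow_le T
  have hU0 : 0 ≤ U := (norm_nonneg _).trans (hU 0)
  refine ⟨E * (∑ i, ‖G.B i‖) * U * |T|, E * ∑ i : Fin np, ‖G.A i.succ‖, by positivity,
    by positivity, fun k => ?_⟩
  induction k with
  | zero =>
    intro t ht
    rw [G.stateTerm_zero hu0 ht.1]
    refine (intervalIntegral.norm_integral_le_of_norm_le_const
      (C := E * (∑ i, ‖G.B i‖) * U) fun s hs => ?_).trans ?_
    · rw [uIoc_of_le ht.1] at hs
      refine (G.norm_flow_mulVec_le (hE _ ⟨by linarith [hs.2], by linarith [hs.1, ht.2]⟩)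
        (norm_affineMatrix_le G.B (hp1 _)) _).trans ?_
      gcongr
      exact hU _
    · simp only [sub_zero, pow_zero, Nat.factorial_zero, Nat.cast_one, div_one, mul_one]
      rw [abs_of_nonneg ht.1]
      exact mul_le_mul_of_nonneg_left (ht.2.trans (le_abs_self _)) (by positivity)
  | succ k ih =>
    intro t ht
    rw [G.stateTerm_succ hp hu hp1 hU hu0 k ht.1]
    refine norm_integral_le_pow_succ_div_factorial ht.1 fun s hs => ?_
    refine (G.norm_flow_mulVec_le (hE _ ⟨by linarith [hs.2], by linarith [hs.1, ht.2]⟩)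
      (G.norm_schedMatrix_le (hp1 _)) _).trans ?_
    gcongr
    exact ih s ⟨hs.1.le, hs.2.trans ht.2⟩

lemma summable_stateTerm
    (hp : Measurable p) (hu : Measurable u) (hp1 : ∀ t i, |p t i| ≤ 1)
    (hU : ∀ t, ‖u t‖ ≤ U) (hu0 : ∀ t < 0, u t = 0) (t : ℝ) : Summable fun k => G.stateTerm p u k t := by
  rcases lt_or_ge t 0 with ht | ht
  · simp only [G.stateTerm_eq_zero hu0 ht]
    exact summable_zero
  · obtain ⟨M, C, -, -, h⟩ := G.exists_norm_stateTerm_le hp hu hp1 hU hu0 t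
    exact Summable.of_norm_bounded ((Real.summable_pow_div_factorial (C * t)).mul_left M)
      fun k => h k t ⟨ht, le_rfl⟩

lemma measurable_tsum_stateTerm
    (hp : Measurable p) (hu : Measurable u) (hp1 : ∀ t i, |p t i| ≤ 1)
    (hU : ∀ t, ‖u t‖ ≤ U) (hu0 : ∀ t < 0, u t = 0) : Measurable fun t => ∑' k, G.stateTerm p u k t := by
  refine measurable_of_tendsto_metrizable
    (f := fun n t => ∑ k ∈ Finset.range n, G.stateTerm p u k t) (fun n => ?_) ?_
  · have := fun k => G.measurable_stateTerm hp hu k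
    exact Finset.measurable_fun_sum _ fun k _ => this k
  · exact tendsto_pi_nhds.2 fun t =>
      (G.summable_stateTerm hp hu hp1 hU hu0 t).hasSum.tendsto_sum_nat

lemma exists_norm_tsum_stateTerm_le
    (hp : Measurable p) (hu : Measurable u) (hp1 : ∀ t i, |p t i| ≤ 1)
    (hU : ∀ t, ‖u t‖ ≤ U) (hu0 : ∀ t < 0, u t = 0) (T : ℝ) :
    ∃ M, ∀ t ∈ Icc 0 T, ‖∑' k, G.stateTerm p u k t‖ ≤ M := by
  obtain ⟨M, C, hM, hC, h⟩ := G.exists_norm_stateTerm_le hp hu hp1 hU hu0 T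
  refine ⟨_, fun t ht => tsum_of_norm_bounded
    ((Real.summable_pow_div_factorial (C * T)).mul_left M).hasSum fun k => (h k t ht).trans ?_⟩
  have := ht.1
  have := ht.2
  gcongr

/-- The right-hand side of the state equation without the term `A_0 x` is bounded. -/
lemma exists_norm_forcing_le
    (hp : Measurable p) (hu : Measurable u) (hp1 : ∀ t i, |p t i| ≤ 1)
    (hU : ∀ t, ‖u t‖ ≤ U) (hu0 : ∀ t < 0, u t = 0) (T : ℝ) : ∃ M, ∀ t ∈ Icc 0 T,
    ‖G.schedMatrix (p t) *ᵥ (∑' k, G.stateTerm p u k t) + affineMatrix G.B (p t) *ᵥ u t‖ ≤ M := by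
  obtain ⟨M, hM⟩ := G.exists_norm_tsum_stateTerm_le hp hu hp1 hU hu0 T
  refine ⟨(∑ i : Fin np, ‖G.A i.succ‖) * M + (∑ i, ‖G.B i‖) * U, fun t ht => ?_⟩
  refine (norm_add_le _ _).trans (add_le_add ?_ ?_)
  · refine (Matrix.linfty_opNorm_mulVec _ _).trans ?_
    exact mul_le_mul (G.norm_schedMatrix_le (hp1 t)) (hM t ht) (norm_nonneg _) (by positivity)
  · refine (Matrix.linfty_opNorm_mulVec _ _).trans ?_
    exact mul_le_mul (norm_affineMatrix_le G.B (hp1 t)) (hU t) (norm_nonneg _) (by positivity)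

lemma measurable_flow_neg_mulVec_forcing
    (hp : Measurable p) (hu : Measurable u) (hp1 : ∀ t i, |p t i| ≤ 1)
    (hU : ∀ t, ‖u t‖ ≤ U) (hu0 : ∀ t < 0, u t = 0) : Measurable fun t => G.flow (-t) *ᵥ
    (G.schedMatrix (p t) *ᵥ (∑' k, G.stateTerm p u k t) + affineMatrix G.B (p t) *ᵥ u t) := by
  refine measurable_matrix_mulVec (fun i j => ?_) (Measurable.add ?_ ?_)
  · exact ((G.continuous_flow.matrix_elem i j).comp continuous_neg).measurable
  · exact measurable_matrix_mulVec (G.measurable_schedMatrix hp)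
      (G.measurable_tsum_stateTerm hp hu hp1 hU hu0)
  · exact measurable_matrix_mulVec (measurable_affineMatrix G.B hp) hu

lemma exists_norm_flow_neg_mulVec_forcing_le
    (hp : Measurable p) (hu : Measurable u) (hp1 : ∀ t i, |p t i| ≤ 1)
    (hU : ∀ t, ‖u t‖ ≤ U) (hu0 : ∀ t < 0, u t = 0) (T : ℝ) : ∃ M, 0 ≤ M ∧ ∀ t ∈ Icc 0 T,
    ‖G.flow (-t) *ᵥ (G.schedMatrix (p t) *ᵥ (∑' k, G.stateTerm p u k t) +
      affineMatrix G.B (p t) *ᵥ u t)‖ ≤ M := by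
  obtain ⟨M, hM⟩ := G.exists_norm_forcing_le hp hu hp1 hU hu0 T
  obtain ⟨E, hE⟩ := isCompact_Icc.exists_bound_of_continuousOn
    ((G.continuous_flow.comp continuous_neg).continuousOn (s := Icc 0 T))
  refine ⟨|E| * |M|, by positivity, fun t ht => (Matrix.linfty_opNorm_mulVec _ _).trans ?_⟩
  exact mul_le_mul ((hE t ht).trans (le_abs_self _)) ((hM t ht).trans (le_abs_self _))
    (norm_nonneg _) (abs_nonneg _)

lemma intervalIntegrable_flow_neg_mulVec_forcing
    (hp : Measurable p) (hu : Measurable u) (hp1 : ∀ t i, |p t i| ≤ 1)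
    (hU : ∀ t, ‖u t‖ ≤ U) (hu0 : ∀ t < 0, u t = 0) {T : ℝ} (hT : 0 ≤ T) :
    IntervalIntegrable (fun t => G.flow (-t) *ᵥ (G.schedMatrix (p t) *ᵥ
      (∑' k, G.stateTerm p u k t) + affineMatrix G.B (p t) *ᵥ u t)) volume 0 T := by
  obtain ⟨M, hM0, hM⟩ := G.exists_norm_flow_neg_mulVec_forcing_le hp hu hp1 hU hu0 T
  rw [intervalIntegrable_iff_integrableOn_Icc_of_le hT]
  exact Measure.integrableOn_of_bounded (M := M) isCompact_Icc.measure_lt_top.ne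
    (G.measurable_flow_neg_mulVec_forcing hp hu hp1 hU hu0).aestronglyMeasurable
    ((ae_restrict_mem measurableSet_Icc).mono fun t ht => hM t ht)

/-- The Volterra series solves the variation of constants equation. -/
lemma tsum_stateTerm_eq
    (hp : Measurable p) (hu : Measurable u) (hp1 : ∀ t i, |p t i| ≤ 1)
    (hU : ∀ t, ‖u t‖ ≤ U) (hu0 : ∀ t < 0, u t = 0) {t : ℝ} (ht : 0 ≤ t) :
    ∑' k, G.stateTerm p u k t = G.flow t *ᵥ ∫ s in (0 : ℝ)..t, G.flow (-s) *ᵥ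
      (G.schedMatrix (p s) *ᵥ (∑' k, G.stateTerm p u k s) + affineMatrix G.B (p s) *ᵥ u s) := by
  obtain ⟨M, C, hM0, hC0, hM⟩ := G.exists_norm_stateTerm_le hp hu hp1 hU hu0 t
  obtain ⟨E, hE0, hE⟩ := G.exists_norm_flow_le t
  have hsum := fun s => G.summable_stateTerm hp hu hp1 hU hu0 s
  have hmf : ∀ {v : ℝ → Fin G.nx → ℝ}, Measurable v → Measurable fun s => G.flow (t - s) *ᵥ v s :=
    fun hv => measurable_matrix_mulVec (fun i j =>
      ((G.continuous_flow.matrix_elem i j).comp (continuous_const.sub continuous_id)).measurable) hv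
  have h1 : HasSum (fun k => G.stateTerm p u (k + 1) t)
      (∫ s in (0 : ℝ)..t, G.flow (t - s) *ᵥ
        (G.schedMatrix (p s) *ᵥ ∑' k, G.stateTerm p u k s)) := by
    simp only [G.stateTerm_succ hp hu hp1 hU hu0 _ ht]
    refine intervalIntegral.hasSum_integral_of_dominated_convergence
      (fun k _ => E * (∑ i : Fin np, ‖G.A i.succ‖) * (M * ((C * t) ^ k / k.factorial)))
      (fun k => (hmf (measurable_matrix_mulVec (G.measurable_schedMatrix hp)
        (G.measurable_stateTerm hp hu k))).aestronglyMeasurable)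
      (fun k => ae_of_all _ fun s hs => ?_) (ae_of_all _ fun s _ => ?_) ?_
      (ae_of_all _ fun s _ => ?_)
    · rw [uIoc_of_le ht] at hs
      refine (G.norm_flow_mulVec_le (hE _ ⟨by linarith [hs.2], by linarith [hs.1]⟩)
        (G.norm_schedMatrix_le (hp1 _)) _).trans ?_
      have h0 := hs.1.le
      have h1 := hs.2
      gcongr
      refine (hM k s ⟨h0, h1⟩).trans ?_
      gcongr
    · exact ((Real.summable_pow_div_factorial (C * t)).mul_left M).mul_left _
    · exact intervalIntegrable_const
    · have := (LinearMap.toContinuousLinearMap (Matrix.mulVecLin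
        (G.flow (t - s) * G.schedMatrix (p s)))).hasSum (hsum s).hasSum
      simpa only [LinearMap.coe_toContinuousLinearMap', Matrix.mulVecLin_apply,
        ← Matrix.mulVec_mulVec] using this
  have h2 : ∑' k, G.stateTerm p u k t = G.stateTerm p u 0 t + ∫ s in (0 : ℝ)..t, G.flow (t - s) *ᵥ
        (G.schedMatrix (p s) *ᵥ ∑' k, G.stateTerm p u k s) := by
    rw [(hsum t).tsum_eq_zero_add, h1.tsum_eq]
  have hint : ∀ {v : ℝ → Fin G.nx → ℝ} {K : ℝ}, Measurable v → (∀ s ∈ Icc 0 t, ‖v s‖ ≤ K) →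
      IntervalIntegrable (fun s => G.flow (t - s) *ᵥ v s) volume 0 t := by
    intro v K hv hK
    rw [intervalIntegrable_iff_integrableOn_Icc_of_le ht]
    refine Measure.integrableOn_of_bounded (M := E * K) isCompact_Icc.measure_lt_top.ne
      (hmf hv).aestronglyMeasurable ((ae_restrict_mem measurableSet_Icc).mono fun s hs => ?_)
    refine (Matrix.linfty_opNorm_mulVec _ _).trans ?_
    exact mul_le_mul (hE _ ⟨by linarith [hs.2], by linarith [hs.1]⟩) (hK s hs) (norm_nonneg _) hE0
  obtain ⟨K, hK⟩ := G.exists_norm_tsum_stateTerm_le hp hu hp1 hU hu0 t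
  rw [h2, G.stateTerm_zero hu0 ht, add_comm, ← intervalIntegral.integral_add]
  · have := (LinearMap.toContinuousLinearMap
      (Matrix.mulVecLin (G.flow t))).intervalIntegral_comp_comm
        (G.intervalIntegrable_flow_neg_mulVec_forcing hp hu hp1 hU hu0 ht)
    simp only [LinearMap.coe_toContinuousLinearMap', Matrix.mulVecLin_apply] at this
    rw [← this]
    refine intervalIntegral.integral_congr fun s _ => ?_
    -- Splitting the flow removes `t` from the integrand, so that the equation can later be
    -- differentiated as a product.
    have e : G.flow (t - s) = G.flow t * G.flow (-s) := by rw [← G.flow_add, sub_eq_add_neg]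
    simp only [e, Matrix.mulVec_add, Matrix.mulVec_mulVec, Matrix.mul_assoc]
  · refine hint (K := (∑ i : Fin np, ‖G.A i.succ‖) * K) (measurable_matrix_mulVec
      (G.measurable_schedMatrix hp) (G.measurable_tsum_stateTerm hp hu hp1 hU hu0)) fun s hs => ?_
    refine (Matrix.linfty_opNorm_mulVec _ _).trans ?_
    exact mul_le_mul (G.norm_schedMatrix_le (hp1 s)) (hK s hs) (norm_nonneg _) (by positivity)
  · refine hint (K := (∑ i, ‖G.B i‖) * U)
      (measurable_matrix_mulVec (measurable_affineMatrix G.B hp) hu) fun s _ => ?_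
    refine (Matrix.linfty_opNorm_mulVec _ _).trans ?_
    exact mul_le_mul (norm_affineMatrix_le G.B (hp1 s)) (hU s) (norm_nonneg _) (by positivity)

/-- Existence of the state trajectory; it is given by the Volterra series. -/
lemma exists_isStateTrajectory
    (hp : Measurable p) (hu : Measurable u) (hp1 : ∀ t i, |p t i| ≤ 1)
    (hU : ∀ t, ‖u t‖ ≤ U) (hu0 : ∀ t < 0, u t = 0) {T : ℝ} (hT : 0 ≤ T) : ∃ x, G.IsStateTrajectory T u p x ∧
    ∀ t ∈ Icc 0 T, x t = ∑' k, G.stateTerm p u k t := by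
  -- Variation of constants: the series equals `G.flow t *ᵥ z t`, where `z` is the integral of the
  -- bounded function `h`. Hence it is Lipschitz on `[0, T]`, and the product rule applies wherever
  -- `z` has derivative `h`, that is, almost everywhere.
  set h : ℝ → Fin G.nx → ℝ := fun t => G.flow (-t) *ᵥ (G.schedMatrix (p t) *ᵥ
      (∑' k, G.stateTerm p u k t) + affineMatrix G.B (p t) *ᵥ u t) with hh
  set z : ℝ → Fin G.nx → ℝ := fun t => ∫ s in (0 : ℝ)..t, h s with hz
  have hint : IntervalIntegrable h volume 0 T :=
    G.intervalIntegrable_flow_neg_mulVec_forcing hp hu hp1 hU hu0 hT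
  have hx : ∀ t ∈ Icc 0 T, G.flow t *ᵥ z t = ∑' k, G.stateTerm p u k t := fun t ht =>
    (G.tsum_stateTerm_eq hp hu hp1 hU hu0 ht.1).symm
  refine ⟨fun t => G.flow t *ᵥ z t, ⟨?_, ?_, ?_⟩, hx⟩
  · obtain ⟨M, hM0, hM⟩ := G.exists_norm_flow_neg_mulVec_forcing_le hp hu hp1 hU hu0 T
    obtain ⟨E, hE0, hE⟩ := G.exists_norm_flow_le T
    have hzlip : ∀ s ∈ Icc 0 T, ∀ t ∈ Icc 0 T, ‖z t - z s‖ ≤ M * |t - s| := by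
      intro s hs t ht
      have hi : ∀ r ∈ Icc 0 T, IntervalIntegrable h volume 0 r := fun r hr =>
        hint.mono_set (by rw [uIcc_of_le hr.1, uIcc_of_le hT]; exact Icc_subset_Icc_right hr.2)
      rw [hz, intervalIntegral.integral_interval_sub_left (hi t ht) (hi s hs)]
      refine intervalIntegral.norm_integral_le_of_norm_le_const fun r hr => hM r ?_
      have : uIcc s t ⊆ Icc 0 T := uIcc_subset_Icc hs ht
      exact this (uIoc_subset_uIcc hr)
    have hflip : ∀ s ∈ Icc 0 T, ∀ t ∈ Icc 0 T,
        ‖G.flow t - G.flow s‖ ≤ ‖G.A 0‖ * E * |t - s| := by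
      intro s hs t ht
      refine (convex_Icc (0 : ℝ) T).norm_image_sub_le_of_norm_hasDerivWithin_le
        (fun r _ => (G.hasDerivAt_flow r).hasDerivWithinAt) (fun r hr => ?_) hs ht
      exact (norm_mul_le _ _).trans (mul_le_mul_of_nonneg_left (hE r hr) (norm_nonneg _))
    have hlip : LipschitzOnWith (‖G.A 0‖ * E * (M * T) + E * M).toNNReal
        (fun t => G.flow t *ᵥ z t) (uIcc 0 T) := by
      rw [uIcc_of_le hT]
      refine LipschitzOnWith.of_dist_le_mul fun t ht s hs => ?_
      rw [Real.coe_toNNReal _ (by positivity), dist_eq_norm, Real.dist_eq]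
      have e : G.flow t *ᵥ z t - G.flow s *ᵥ z s =
          (G.flow t - G.flow s) *ᵥ z t + G.flow s *ᵥ (z t - z s) := by
        rw [Matrix.sub_mulVec, Matrix.mulVec_sub]; abel
      rw [e, add_mul]
      have hz0 : z 0 = 0 := by simp [hz]
      have hzt : ‖z t‖ ≤ M * T := by
        have := hzlip 0 ⟨le_rfl, hT⟩ t ht
        rw [hz0, sub_zero, sub_zero, abs_of_nonneg ht.1] at this
        exact this.trans (mul_le_mul_of_nonneg_left ht.2 hM0)
      refine (norm_add_le _ _).trans (add_le_add ?_ ?_)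
      · refine (Matrix.linfty_opNorm_mulVec _ _).trans ?_
        refine (mul_le_mul (hflip s hs t ht) hzt (norm_nonneg _) (by positivity)).trans_eq (by ring)
      · refine (Matrix.linfty_opNorm_mulVec _ _).trans ?_
        refine (mul_le_mul (hE s hs) (hzlip s hs t ht) (norm_nonneg _) hE0).trans_eq (by ring)
    exact hlip.absolutelyContinuousOnInterval
  · simp [hz]
  · have hae := hint.ae_hasDerivAt_integral
    rw [ae_restrict_iff' measurableSet_Icc]
    filter_upwards [hae] with t hd ht
    have hzd : HasDerivAt z (h t) t :=
      hd (by rwa [uIcc_of_le hT]) 0 (by rw [uIcc_of_le hT]; exact ⟨le_rfl, hT⟩)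
    have hb := (isBoundedBilinearMap_mulVec G.nx G.nx).hasFDerivAt (G.flow t, z t)
    have hc := hb.comp_hasDerivAt t ((G.hasDerivAt_flow t).prodMk hzd)
    have hc' : HasDerivAt (fun t => G.flow t *ᵥ z t)
        (G.flow t *ᵥ h t + (G.A 0 * G.flow t) *ᵥ z t) t := hc
    have e : affineMatrix G.A (p t) *ᵥ (G.flow t *ᵥ z t) + affineMatrix G.B (p t) *ᵥ u t =
        G.flow t *ᵥ h t + (G.A 0 * G.flow t) *ᵥ z t := by
      rw [affineMatrix_A_eq, Matrix.add_mulVec, hh, Matrix.mulVec_mulVec (M := G.flow t),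
        ← G.flow_add, add_neg_cancel, flow_zero, Matrix.one_mulVec, ← Matrix.mulVec_mulVec,
        ← hx t ht]
      abel
    rw [e]
    exact hc'

end LPVSystem

/-! ### Uniqueness of the trajectory and the series for the output -/

namespace LPVSystem

open scoped Matrix.Norms.Operator

variable {np nin : ℕ} {G : LPVSystem np nin} {p : ℝ → Fin np → ℝ} {u : ℝ → Fin nin → ℝ} {U : ℝ}

/-- Uniqueness of the state trajectory. -/
lemma IsStateTrajectory.eqOn (hp : Measurable p) (hp1 : ∀ t i, |p t i| ≤ 1) {T : ℝ} (hT : 0 ≤ T)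
    {x y : ℝ → Fin G.nx → ℝ} (hx : G.IsStateTrajectory T u p x) (hy : G.IsStateTrajectory T u p y) :
    EqOn x y (Icc 0 T) := by
  set d : ℝ → Fin G.nx → ℝ := x - y with hd
  have hdac : AbsolutelyContinuousOnInterval d 0 T := hx.absCont.sub hy.absCont
  have hdc : ContinuousOn d (Icc 0 T) := by
    have := hdac.continuousOn
    rwa [uIcc_of_le hT] at this
  obtain ⟨M, hM⟩ := isCompact_Icc.exists_bound_of_continuousOn hdc
  have hM0 : 0 ≤ M := (norm_nonneg _).trans (hM 0 ⟨le_rfl, hT⟩)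
  set C := ∑ i, ‖G.A i‖ with hC
  have hC0 : 0 ≤ C := by positivity
  -- Extending `d` by its endpoint values makes the integrand `h` measurable and bounded on the
  -- whole line.
  set e : ℝ → Fin G.nx → ℝ := fun t => d (projIcc 0 T hT t) with he
  have hec : Continuous e :=
    (continuousOn_iff_continuous_domRestrict.1 hdc).comp continuous_projIcc
  have hed : ∀ t ∈ Icc 0 T, e t = d t := fun t ht => by rw [he]; simp [projIcc_of_mem hT ht]
  have heM : ∀ t, ‖e t‖ ≤ M := fun t => hM _ (projIcc 0 T hT t).2
  set h : ℝ → Fin G.nx → ℝ := fun t => affineMatrix G.A (p t) *ᵥ e t with hh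
  have hm : Measurable h :=
    measurable_matrix_mulVec (measurable_affineMatrix G.A hp) hec.measurable
  have hhC : ∀ t, ‖h t‖ ≤ C * ‖e t‖ := fun t => (Matrix.linfty_opNorm_mulVec _ _).trans
    (mul_le_mul_of_nonneg_right (norm_affineMatrix_le G.A (hp1 t)) (norm_nonneg _))
  have hhM : ∀ t, ‖h t‖ ≤ C * M := fun t =>
    (hhC t).trans (mul_le_mul_of_nonneg_left (heM t) hC0)
  have hint : ∀ a b, IntervalIntegrable h volume a b := fun a b => by
    rw [intervalIntegrable_iff]
    exact Measure.integrableOn_of_bounded (M := C * M)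
      (measure_mono uIoc_subset_uIcc |>.trans_lt isCompact_uIcc.measure_lt_top).ne
      hm.aestronglyMeasurable (ae_of_all _ hhM)
  set g : ℝ → Fin G.nx → ℝ := fun t => ∫ s in (0 : ℝ)..t, h s with hg
  have hgac : AbsolutelyContinuousOnInterval g 0 T := by
    have : LipschitzOnWith (C * M).toNNReal g (uIcc 0 T) := by
      refine LipschitzOnWith.of_dist_le_mul fun t _ s _ => ?_
      rw [Real.coe_toNNReal _ (by positivity), dist_eq_norm, Real.dist_eq, hg,
        intervalIntegral.integral_interval_sub_left (hint _ _) (hint _ _)]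
      exact intervalIntegral.norm_integral_le_of_norm_le_const fun r _ => hhM r
    exact this.absolutelyContinuousOnInterval
  -- Absolute continuity is essential here: an almost everywhere vanishing derivative then forces a
  -- constant, so `d` satisfies the homogeneous integral equation.
  obtain ⟨c, hc⟩ := (hdac.sub hgac).const_of_ae_hasDerivAt_zero (by
    have h1 := (ae_restrict_iff' measurableSet_Icc).1 hx.ode
    have h2 := (ae_restrict_iff' measurableSet_Icc).1 hy.ode
    rw [uIcc_of_le hT]
    filter_upwards [h1, h2, (hint 0 T).ae_hasDerivAt_integral] with t h1 h2 h3 ht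
    have h3 : HasDerivAt g (h t) t :=
      h3 (by rwa [uIcc_of_le hT]) 0 (by rw [uIcc_of_le hT]; exact ⟨le_rfl, hT⟩)
    have h4 := ((h1 ht).sub (h2 ht)).sub h3
    have e0 : affineMatrix G.A (p t) *ᵥ x t + affineMatrix G.B (p t) *ᵥ u t -
        (affineMatrix G.A (p t) *ᵥ y t + affineMatrix G.B (p t) *ᵥ u t) - h t = 0 := by
      simp only [hh]
      rw [hed t ht, hd, Pi.sub_apply, Matrix.mulVec_sub]
      abel
    rwa [e0] at h4)
  rw [uIcc_of_le hT] at hc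
  have hc0 : c = 0 := by
    rw [← hc 0 ⟨le_rfl, hT⟩]
    simp [hd, hg, hx.init, hy.init]
  have hdg : ∀ t ∈ Icc 0 T, d t = g t := fun t ht => by
    have := hc t ht
    rw [hc0] at this
    exact sub_eq_zero.1 this
  -- Feeding a bound on `d` back into its integral equation gains one power and one factorial factor
  -- each time; in the limit `d = 0`.
  have hiter : ∀ k : ℕ, ∀ t ∈ Icc 0 T, ‖d t‖ ≤ M * ((C * t) ^ k / k.factorial) := by
    intro k
    induction k with
    | zero => simpa using hM
    | succ k ih =>
      intro t ht
      rw [hdg t ht]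
      refine norm_integral_le_pow_succ_div_factorial ht.1 fun s hs => ?_
      have hsT : s ∈ Icc 0 T := ⟨hs.1.le, hs.2.trans ht.2⟩
      refine (hhC s).trans (mul_le_mul_of_nonneg_left ?_ hC0)
      rw [hed s hsT]
      exact ih s hsT
  intro t ht
  have hlim : Tendsto (fun k : ℕ => M * ((C * t) ^ k / k.factorial)) atTop (𝓝 (M * 0)) :=
    (FloorSemiring.tendsto_pow_div_factorial_atTop (C * t)).const_mul M
  rw [mul_zero] at hlim
  have : ‖d t‖ ≤ 0 := ge_of_tendsto' hlim fun k => hiter k t ht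
  exact sub_eq_zero.1 (norm_le_zero_iff.1 this)

/-- The output is given by the Volterra series of the signals cut off outside `[0, T]`. -/
lemma output_eq_tsum (G : LPVSystem np nin) {T : ℝ} (hT : 0 ≤ T)
    (hp : PiecewiseContinuousOn p 0 T) (hp1 : ∀ t ∈ Icc 0 T, ∀ i, p t i ∈ Icc (-1 : ℝ) 1)
    (hu : PiecewiseContinuousOn u 0 T) :
    G.output T u p T = (affineMatrix G.C (p T) *ᵥ ∑' k, G.stateTerm ((Icc 0 T).indicator p)
      ((Icc 0 T).indicator u) k T) 0 := by
  obtain ⟨U, hU⟩ := hu.exists_norm_indicator_le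
  have hpm := hp.measurable_indicator
  have hum := hu.measurable_indicator
  have hp1' : ∀ t i, |(Icc 0 T).indicator p t i| ≤ 1 := fun t i => by
    by_cases h : t ∈ Icc 0 T
    · rw [indicator_of_mem h]; exact abs_le.2 (hp1 t h i)
    · rw [indicator_of_notMem h]; simp
  have hu0 : ∀ t < 0, (Icc 0 T).indicator u t = 0 := fun t ht =>
    indicator_of_notMem (fun h => absurd h.1 (not_le.2 ht)) _
  have hiff : ∀ x, G.IsStateTrajectory T u p x →
      G.IsStateTrajectory T ((Icc 0 T).indicator u) ((Icc 0 T).indicator p) x := by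
    intro x hx
    refine ⟨hx.absCont, hx.init, ?_⟩
    filter_upwards [hx.ode, ae_restrict_mem measurableSet_Icc] with t ht hmem
    rwa [indicator_of_mem hmem, indicator_of_mem hmem]
  obtain ⟨x, hx, hxs⟩ := G.exists_isStateTrajectory hpm hum hp1' hU hu0 hT
  have hex : ∃ x, G.IsStateTrajectory T u p x := by
    refine ⟨x, hx.absCont, hx.init, ?_⟩
    filter_upwards [hx.ode, ae_restrict_mem measurableSet_Icc] with t ht hmem
    rwa [indicator_of_mem hmem, indicator_of_mem hmem] at ht
  have hTT : T ∈ Icc 0 T := ⟨hT, le_rfl⟩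
  -- Uniqueness makes the chosen trajectory agree at `T` with the one given by the series; the
  -- cutoff is harmless because the state equation sees the signals on `[0, T]` only.
  rw [output, dif_pos hex, (hiff _ hex.choose_spec).eqOn hpm hp1' hT hx hTT, hxs T hTT]

end LPVSystem

/-! ### Measures on countable disjoint unions -/

section SigmaMeasure

variable {ι : Type*} {β : ι → Type*} [∀ i, MeasurableSpace (β i)]

lemma measurableSet_sigma_iff {s : Set (Sigma β)} :
    MeasurableSet s ↔ ∀ i, MeasurableSet (Sigma.mk i ⁻¹' s) :=
  MeasurableSpace.measurableSet_iInf

lemma measurable_sigma_iff {γ : Type*} [MeasurableSpace γ] {f : Sigma β → γ} :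
    Measurable f ↔ ∀ i, Measurable fun x => f ⟨i, x⟩ :=
  ⟨fun h _ _ hs => measurableSet_sigma_iff.1 (h hs) _,
    fun h _ hs => measurableSet_sigma_iff.2 fun i => h i hs⟩

lemma measurable_sigmaMk (i : ι) : Measurable (Sigma.mk i : β i → Sigma β) :=
  measurable_sigma_iff.1 measurable_id i

/-- Countable generation is what makes L² of the kernel space separable. Each whole fibre is added
to the generators because complements must be taken within the fibre. -/
instance countablyGenerated_sigma [Countable ι]
    [∀ i, MeasurableSpace.CountablyGenerated (β i)] :
    MeasurableSpace.CountablyGenerated (Sigma β) where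
  isCountablyGenerated := by
    refine ⟨⋃ i, (fun s => Sigma.mk i '' s) ''
      (insert univ (MeasurableSpace.countableGeneratingSet (β i))),
      countable_iUnion fun i => ((MeasurableSpace.countable_countableGeneratingSet).insert
        univ).image _, ?_⟩
    set m := MeasurableSpace.generateFrom (⋃ i, (fun s => (Sigma.mk i '' s : Set (Sigma β))) ''
      (insert univ (MeasurableSpace.countableGeneratingSet (β i)))) with hm
    refine le_antisymm ?_ (MeasurableSpace.generateFrom_le ?_)
    · have key : ∀ i (s : Set (β i)), MeasurableSet s → MeasurableSet[m] (Sigma.mk i '' s) := by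
        intro i s hs
        have huniv : MeasurableSet[m] (Sigma.mk i '' (univ : Set (β i))) :=
          MeasurableSpace.measurableSet_generateFrom
            (mem_iUnion.2 ⟨i, mem_image_of_mem _ (mem_insert _ _)⟩)
        rw [← MeasurableSpace.generateFrom_countableGeneratingSet (α := β i)] at hs
        induction s, hs using MeasurableSpace.generateFrom_induction with
        | hC s hs =>
          exact MeasurableSpace.measurableSet_generateFrom
            (mem_iUnion.2 ⟨i, mem_image_of_mem _ (mem_insert_of_mem _ hs)⟩)
        | empty => rw [image_empty]; exact @MeasurableSet.empty _ m
        | compl s _ ih =>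
          rw [compl_eq_univ_sdiff, image_sdiff sigma_mk_injective]
          exact @MeasurableSet.diff _ m _ _ huniv ih
        | iUnion s _ ih =>
          rw [image_iUnion]
          exact @MeasurableSet.iUnion _ _ m _ _ ih
      intro s hs
      have : s = ⋃ i, Sigma.mk i '' (Sigma.mk i ⁻¹' s) := by
        ext x
        simp only [mem_iUnion, mem_image, mem_preimage]
        exact ⟨fun h => ⟨x.1, x.2, h, rfl⟩, by rintro ⟨i, y, hy, rfl⟩; exact hy⟩
      rw [this]
      exact @MeasurableSet.iUnion _ _ m _ _ fun i => key i _ (measurableSet_sigma_iff.1 hs i)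
    · intro t ht
      obtain ⟨i, s, hs, rfl⟩ := mem_iUnion.1 ht
      have hsm : MeasurableSet s := by
        rcases hs with rfl | hs
        · exact MeasurableSet.univ
        · exact MeasurableSpace.measurableSet_countableGeneratingSet hs
      refine measurableSet_sigma_iff.2 fun j => ?_
      by_cases hij : i = j
      · subst hij
        rwa [sigma_mk_preimage_image_eq_self]
      · rw [preimage_image_sigmaMk_of_ne (Ne.symm hij)]
        exact MeasurableSet.empty

/-- The measure on a sigma type with given restrictions to the fibres. -/
noncomputable def sigmaMeasure (μ : ∀ i, Measure (β i)) : Measure (Sigma β) :=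
  Measure.sum fun i => (μ i).map (Sigma.mk i)

variable {μ : ∀ i, Measure (β i)}

instance [Countable ι] [∀ i, SFinite (μ i)] : SFinite (sigmaMeasure μ) := by
  unfold sigmaMeasure
  infer_instance

lemma lintegral_sigmaMeasure {f : Sigma β → ℝ≥0∞} (hf : Measurable f) :
    ∫⁻ x, f x ∂(sigmaMeasure μ) = ∑' i, ∫⁻ x, f ⟨i, x⟩ ∂(μ i) := by
  rw [sigmaMeasure, lintegral_sum_measure]
  exact tsum_congr fun i => lintegral_map hf (measurable_sigmaMk i)

lemma hasSum_integral_sigmaMeasure {f : Sigma β → ℝ} (hf : Measurable f)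
    (hi : Integrable f (sigmaMeasure μ)) :
    HasSum (fun i => ∫ x, f ⟨i, x⟩ ∂(μ i)) (∫ x, f x ∂(sigmaMeasure μ)) := by
  have := hasSum_integral_measure hi
  simp only [integral_map (measurable_sigmaMk _).aemeasurable hf.aestronglyMeasurable] at this
  exact this

lemma integrable_fiber_of_sigmaMeasure {f : Sigma β → ℝ} (hf : Measurable f)
    (hi : Integrable f (sigmaMeasure μ)) (i : ι) : Integrable (fun x => f ⟨i, x⟩) (μ i) := by
  have := hi.mono_measure (Measure.le_sum (fun i => (μ i).map (Sigma.mk i)) i)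
  exact (integrable_map_measure hf.aestronglyMeasurable (measurable_sigmaMk _).aemeasurable).1 this

end SigmaMeasure

lemma eLpNorm_two_eq_lintegral_sq {α : Type*} [MeasurableSpace α] {μ : Measure α} (f : α → ℝ) :
    eLpNorm f 2 μ = (∫⁻ x, ENNReal.ofReal (f x ^ 2) ∂μ) ^ (1 / 2 : ℝ) := by
  rw [eLpNorm_eq_lintegral_rpow_enorm_toReal two_ne_zero ENNReal.ofNat_ne_top]
  simp only [ENNReal.toReal_ofNat]
  congr 1
  refine lintegral_congr fun x => ?_
  rw [← ofReal_norm, ENNReal.ofReal_rpow_of_nonneg (norm_nonneg _) two_pos.le, Real.rpow_two,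
    Real.norm_eq_abs, sq_abs]

/-! ### The output as an inner product in L² -/

namespace LPVSystem

/-- The indices `(k, i_q, i_r, I, j)` of the scalar Volterra kernels. -/
abbrev KernelIndex (np nin : ℕ) : Type :=
  Σ k : ℕ, (Fin (np + 1) × Fin (np + 1)) × (Fin k → Fin np) × Fin nin

/-- The disjoint union of the domains of the scalar Volterra kernels. -/
abbrev KernelSpace (np nin : ℕ) : Type := Σ a : KernelIndex np nin, (Fin (a.1 + 1) → ℝ)

/-- The measure on `KernelSpace` that restricts to Lebesgue measure on each simplex. -/
noncomputable def kernelMeasure (np nin : ℕ) : Measure (KernelSpace np nin) :=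
  sigmaMeasure fun a => volume.restrict (timeSimplex (a.1 + 1))

instance (np nin : ℕ) : SFinite (kernelMeasure np nin) := by
  unfold kernelMeasure
  infer_instance

variable {np nin : ℕ}

/-- The family of all scalar Volterra kernels, as one function. -/
noncomputable def kernelFun (G : LPVSystem np nin) (lam : ℝ) (x : KernelSpace np nin) : ℝ :=
  G.volterraKernel lam x.1.2.1.1 x.1.2.1.2 x.1.2.2.1 x.2 0 x.1.2.2.2

/-- The function of the signals that is paired with the Volterra kernels. -/
noncomputable def featureFun (lam T : ℝ) (p : ℝ → Fin np → ℝ) (u : ℝ → Fin nin → ℝ)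
    (x : KernelSpace np nin) : ℝ :=
  Real.exp (-(lam / 2 * x.2 (Fin.last _))) * (Fin.cons 1 (p T) : Fin (np + 1) → ℝ) x.1.2.1.1 *
    schedWeight p x.1.2.1.2 x.1.2.2.1 T x.2 * u (T - x.2 (Fin.last _)) x.1.2.2.2

lemma measurable_kernelFun (G : LPVSystem np nin) (lam : ℝ) : Measurable (G.kernelFun lam) := by
  refine measurable_sigma_iff.2 fun a => ?_
  obtain ⟨k, ⟨iq, ir⟩, I, j⟩ := a
  change Measurable fun τ : Fin (k + 1) → ℝ => G.volterraKernel lam iq ir I τ 0 j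
  simp only [volterraKernel, Matrix.smul_apply, smul_eq_mul]
  refine Measurable.mul (by fun_prop) ?_
  exact ((continuous_const.matrix_mul (G.continuous_inputKernel ir k I)).matrix_elem 0 j).measurable

lemma measurable_featureFun (lam T : ℝ) {p : ℝ → Fin np → ℝ} (hp : Measurable p)
    {u : ℝ → Fin nin → ℝ} (hu : Measurable u) : Measurable (featureFun lam T p u) := by
  refine measurable_sigma_iff.2 fun a => ?_
  obtain ⟨k, ⟨iq, ir⟩, I, j⟩ := a
  simp only [featureFun]
  refine Measurable.mul (Measurable.mul (by fun_prop) ?_) ?_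
  · exact Measurable.of_uncurry_left (f := fun t τ => schedWeight p ir I t τ)
      (measurable_schedWeight hp ir I)
  · exact (measurable_pi_apply j).comp (hu.comp (by fun_prop))

lemma lintegral_kernelMeasure {f : KernelSpace np nin → ℝ≥0∞} (hf : Measurable f) :
    ∫⁻ x, f x ∂(kernelMeasure np nin) = ∑' k, ∑ iq, ∑ ir, ∑ I : Fin k → Fin np, ∑ j,
      ∫⁻ τ in timeSimplex (k + 1), f ⟨⟨k, (iq, ir), I, j⟩, τ⟩ := by
  rw [kernelMeasure, lintegral_sigmaMeasure hf, ENNReal.tsum_sigma']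
  refine tsum_congr fun k => ?_
  rw [tsum_fintype, Fintype.sum_prod_type, Fintype.sum_prod_type]
  refine Finset.sum_congr rfl fun iq _ => Finset.sum_congr rfl fun ir _ => ?_
  rw [Fintype.sum_prod_type]

/-- The weighted `H_2` norm is an `L²` norm of the Volterra kernels. -/
lemma eLpNorm_kernelFun (G : LPVSystem np nin) (lam : ℝ) :
    eLpNorm (G.kernelFun lam) 2 (kernelMeasure np nin) = G.h2Norm lam := by
  have hm := G.measurable_kernelFun lam
  rw [eLpNorm_two_eq_lintegral_sq, h2Norm, h2NormSq,
    lintegral_kernelMeasure (hm.pow_const 2).ennreal_ofReal]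
  congr 1
  have e : ∀ (k : ℕ) (iq ir : Fin (np + 1)) (I : Fin k → Fin np),
      ∑ j, ∫⁻ τ in timeSimplex (k + 1),
        ENNReal.ofReal (G.kernelFun lam ⟨⟨k, (iq, ir), I, j⟩, τ⟩ ^ 2) =
      ∫⁻ τ in timeSimplex (k + 1),
        ENNReal.ofReal (∑ j : Fin nin, (G.volterraKernel lam iq ir I τ 0 j) ^ 2) := by
    intro k iq ir I
    rw [← lintegral_finsetSum]
    · refine lintegral_congr fun τ => ?_
      rw [ENNReal.ofReal_sum_of_nonneg fun j _ => sq_nonneg _]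
      rfl
    · intro j _
      exact (((measurable_sigma_iff.1 hm ⟨k, (iq, ir), I, j⟩)).pow_const 2).ennreal_ofReal
  simp only [e]
  rw [Summable.tsum_finsetSum fun _ _ => ENNReal.summable]
  refine Finset.sum_congr rfl fun iq _ => ?_
  rw [Summable.tsum_finsetSum fun _ _ => ENNReal.summable]

lemma abs_schedWeight_le {p : ℝ → Fin np → ℝ} (hp1 : ∀ t i, |p t i| ≤ 1) (ir : Fin (np + 1))
    {k : ℕ} (I : Fin k → Fin np) (t : ℝ) (τ : Fin (k + 1) → ℝ) : |schedWeight p ir I t τ| ≤ 1 := by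
  rw [schedWeight, abs_mul, Finset.abs_prod]
  refine mul_le_one₀ ?_ (Finset.prod_nonneg fun _ _ => abs_nonneg _)
    (Finset.prod_le_one (fun _ _ => abs_nonneg _) fun _ _ => hp1 _ _)
  cases ir using Fin.cases with
  | zero => simp
  | succ i => simpa using hp1 _ i

lemma featureFun_sq_le {lam T : ℝ} {p : ℝ → Fin np → ℝ} (hp1 : ∀ t i, |p t i| ≤ 1)
    {u : ℝ → Fin nin → ℝ} (x : KernelSpace np nin) :
    featureFun lam T p u x ^ 2 ≤ Real.exp (-(lam * x.2 (Fin.last _))) *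
      u (T - x.2 (Fin.last _)) x.1.2.2.2 ^ 2 := by
  have h1 : (Fin.cons 1 (p T) : Fin (np + 1) → ℝ) x.1.2.1.1 ^ 2 ≤ 1 := by
    rw [sq_le_one_iff_abs_le_one]
    cases x.1.2.1.1 using Fin.cases with
    | zero => simp
    | succ i => simpa using hp1 _ i
  have h2 : schedWeight p x.1.2.1.2 x.1.2.2.1 T x.2 ^ 2 ≤ 1 := by
    rw [sq_le_one_iff_abs_le_one]
    exact abs_schedWeight_le hp1 _ _ _ _
  have h3 : Real.exp (-(lam / 2 * x.2 (Fin.last _))) ^ 2 =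
      Real.exp (-(lam * x.2 (Fin.last _))) := by
    rw [← Real.exp_nat_mul]; congr 1; push_cast; ring
  rw [featureFun, mul_pow, mul_pow, mul_pow, h3]
  refine mul_le_mul_of_nonneg_right ?_ (sq_nonneg _)
  exact (mul_le_of_le_one_right (by positivity) h2).trans
    (mul_le_of_le_one_right (Real.exp_nonneg _) h1)

lemma tsum_ofReal_pow_div_factorial {x : ℝ} (hx : 0 ≤ x) :
    ∑' k : ℕ, ENNReal.ofReal (x ^ k / k.factorial) = ENNReal.ofReal (Real.exp x) := by
  rw [← ENNReal.ofReal_tsum_of_nonneg (fun k => by positivity) (Real.summable_pow_div_factorial x),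
    Real.exp_eq_exp_ℝ, NormedSpace.exp_eq_tsum_div]

/-- The `L²` norm of the feature function is controlled by the `L²` norm of the input. -/
lemma lintegral_featureFun_sq_le {lam T : ℝ} (hlam : (np : ℝ) ≤ lam) {p : ℝ → Fin np → ℝ}
    (hp : Measurable p) (hp1 : ∀ t i, |p t i| ≤ 1) {u : ℝ → Fin nin → ℝ} (hu : Measurable u) :
    ∫⁻ x, ENNReal.ofReal (featureFun lam T p u x ^ 2) ∂(kernelMeasure np nin) ≤
      ((np : ℝ≥0∞) + 1) ^ 2 * ∫⁻ t, ENNReal.ofReal (∑ j, u t j ^ 2) := by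
  set g : ℝ → ℝ≥0∞ := fun t =>
    ENNReal.ofReal (Real.exp (-(lam * t)) * ∑ j, u (T - t) j ^ 2) with hg
  have huj : ∀ j, Measurable fun t => u (T - t) j := fun j =>
    (measurable_pi_apply j).comp (hu.comp (by fun_prop))
  have hgm : Measurable g := by fun_prop
  rw [lintegral_kernelMeasure ((measurable_featureFun lam T hp hu).pow_const 2).ennreal_ofReal]
  have e : ∀ (k : ℕ) (iq ir : Fin (np + 1)) (I : Fin k → Fin np),
      ∑ j, ∫⁻ τ in timeSimplex (k + 1),
        ENNReal.ofReal (featureFun lam T p u ⟨⟨k, (iq, ir), I, j⟩, τ⟩ ^ 2) ≤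
      ∫⁻ t in Ici (0 : ℝ), g t * ENNReal.ofReal (t ^ k / k.factorial) := by
    intro k iq ir I
    rw [← lintegral_timeSimplex_last k hgm]
    calc _ ≤ ∑ j, ∫⁻ τ in timeSimplex (k + 1), ENNReal.ofReal
          (Real.exp (-(lam * τ (Fin.last k))) * u (T - τ (Fin.last k)) j ^ 2) :=
          Finset.sum_le_sum fun j _ => lintegral_mono fun τ =>
            ENNReal.ofReal_le_ofReal (featureFun_sq_le hp1 ⟨⟨k, (iq, ir), I, j⟩, τ⟩)
      _ = _ := by
          rw [← lintegral_finsetSum]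
          · refine lintegral_congr fun τ => ?_
            rw [← ENNReal.ofReal_sum_of_nonneg fun j _ => by positivity, hg]
            simp only [Finset.mul_sum]
          · intro j _
            have : Measurable fun t => ENNReal.ofReal (Real.exp (-(lam * t)) * u (T - t) j ^ 2) := by
              have := huj j
              fun_prop
            exact this.comp (measurable_pi_apply (Fin.last k))
  calc _ ≤ ∑' k : ℕ, ∑ _iq : Fin (np + 1), ∑ _ir : Fin (np + 1), ∑ _I : Fin k → Fin np,
        ∫⁻ t in Ici (0 : ℝ), g t * ENNReal.ofReal (t ^ k / k.factorial) :=
        ENNReal.tsum_le_tsum fun k => Finset.sum_le_sum fun iq _ => Finset.sum_le_sum fun ir _ =>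
          Finset.sum_le_sum fun I _ => e k iq ir I
    -- The bound is the same for all indices: the pairs `(iq, ir)` contribute `(np + 1) ^ 2`, and
    -- the `np ^ k` multi-indices turn `t ^ k` into `(np * t) ^ k`, so that the sum over `k` is an
    -- exponential.
    _ = ∑' k : ℕ, ((np : ℝ≥0∞) + 1) ^ 2 *
          ∫⁻ t in Ici (0 : ℝ), g t * ENNReal.ofReal ((np * t) ^ k / k.factorial) := by
        refine tsum_congr fun k => ?_
        have e2 : ∀ t : ℝ, g t * ENNReal.ofReal ((np * t) ^ k / k.factorial) =
            (np : ℝ≥0∞) ^ k * (g t * ENNReal.ofReal (t ^ k / k.factorial)) := by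
          intro t
          rw [mul_pow, mul_div_assoc, ENNReal.ofReal_mul (by positivity),
            ENNReal.ofReal_pow (by positivity), ENNReal.ofReal_natCast]
          ring
        simp only [e2]
        rw [lintegral_const_mul _ (by fun_prop)]
        simp only [Finset.sum_const, Finset.card_univ, Fintype.card_fin, Fintype.card_pi_const,
          nsmul_eq_mul]
        push_cast
        ring
    _ = ((np : ℝ≥0∞) + 1) ^ 2 * ∫⁻ t in Ici (0 : ℝ),
          ∑' k : ℕ, g t * ENNReal.ofReal ((np * t) ^ k / k.factorial) := by
        rw [ENNReal.tsum_mul_left, lintegral_tsum fun k => by fun_prop]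
    _ ≤ ((np : ℝ≥0∞) + 1) ^ 2 * ∫⁻ t in Ici (0 : ℝ), ENNReal.ofReal (∑ j, u (T - t) j ^ 2) := by
        refine mul_le_mul_right (setLIntegral_mono' measurableSet_Ici fun t ht => ?_) _
        have ht : 0 ≤ t := ht
        rw [ENNReal.tsum_mul_left, tsum_ofReal_pow_div_factorial (by positivity), hg,
          ← ENNReal.ofReal_mul (by positivity)]
        refine ENNReal.ofReal_le_ofReal ?_
        -- Here `np ≤ lam` balances the growth of the series against the weight, for all `t ≥ 0` at
        -- once; this makes the final bound independent of `T`.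
        have h1 : Real.exp (-(lam * t)) * Real.exp (np * t) ≤ 1 := by
          rw [← Real.exp_add, Real.exp_le_one_iff]
          nlinarith
        have h2 : 0 ≤ ∑ j, u (T - t) j ^ 2 := by positivity
        nlinarith
    _ ≤ ((np : ℝ≥0∞) + 1) ^ 2 * ∫⁻ t, ENNReal.ofReal (∑ j, u (T - t) j ^ 2) :=
        mul_le_mul_right (setLIntegral_le_lintegral _ _) _
    _ = _ := by
        rw [lintegral_sub_left_eq_self (fun t => ENNReal.ofReal (∑ j, u t j ^ 2)) T]

/-- Separates the integrand into a factor depending on the system alone and a factor depending on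
the signals alone; the exponential weights of the two cancel. -/
lemma mulVec_stateKernel_eq_sum (G : LPVSystem np nin) (lam T : ℝ) (p : ℝ → Fin np → ℝ)
    (u : ℝ → Fin nin → ℝ) (k : ℕ) (τ : Fin (k + 1) → ℝ) :
    (affineMatrix G.C (p T) *ᵥ G.stateKernel p u k T τ) 0 =
      ∑ iq, ∑ ir, ∑ I : Fin k → Fin np, ∑ j, G.kernelFun lam ⟨⟨k, (iq, ir), I, j⟩, τ⟩ *
        featureFun lam T p u ⟨⟨k, (iq, ir), I, j⟩, τ⟩ := by
  have hexp : Real.exp (lam / 2 * τ (Fin.last k)) * Real.exp (-(lam / 2 * τ (Fin.last k))) = 1 := by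
    rw [← Real.exp_add, add_neg_cancel, Real.exp_zero]
  have hC : ∀ x, affineMatrix G.C (p T) *ᵥ x =
      ∑ i, (Fin.cons 1 (p T) : Fin (np + 1) → ℝ) i • (G.C i *ᵥ x) := fun x => by
    rw [affineMatrix_eq_sum, Matrix.sum_mulVec]
    simp only [Matrix.smul_mulVec]
  have hs : G.stateKernel p u k T τ = ∑ ir, ∑ I : Fin k → Fin np, schedWeight p ir I T τ •
      (G.inputKernel ir k I τ *ᵥ u (T - τ (Fin.last k))) := by
    rw [stateKernel, Finset.sum_comm]
  rw [hC, hs]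
  simp only [Matrix.mulVec_sum, Matrix.mulVec_smul, Matrix.mulVec_mulVec, Finset.sum_apply,
    Pi.smul_apply, smul_eq_mul, Finset.mul_sum]
  refine Finset.sum_congr rfl fun iq _ => Finset.sum_congr rfl fun ir _ =>
    Finset.sum_congr rfl fun I _ => ?_
  simp only [Matrix.mulVec, dotProduct, Finset.mul_sum]
  refine Finset.sum_congr rfl fun j _ => ?_
  simp only [kernelFun, featureFun, volterraKernel, Matrix.smul_apply, smul_eq_mul]
  linear_combination (-(Fin.cons 1 (p T) : Fin (np + 1) → ℝ) iq * schedWeight p ir I T τ *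
    (G.C iq * G.inputKernel ir k I τ) 0 j * u (T - τ (Fin.last k)) j) * hexp

/-- The Volterra series of the output as an `L²` pairing. -/
lemma integral_kernelFun_mul_featureFun (G : LPVSystem np nin) {lam T : ℝ} {p : ℝ → Fin np → ℝ}
    {u : ℝ → Fin nin → ℝ} {U : ℝ} (hp : Measurable p) (hu : Measurable u)
    (hp1 : ∀ t i, |p t i| ≤ 1) (hU : ∀ t, ‖u t‖ ≤ U) (hu0 : ∀ t < 0, u t = 0)
    (hi : Integrable (fun x => G.kernelFun lam x * featureFun lam T p u x)
      (kernelMeasure np nin)) :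
    ∫ x, G.kernelFun lam x * featureFun lam T p u x ∂(kernelMeasure np nin) =
      (affineMatrix G.C (p T) *ᵥ ∑' k, G.stateTerm p u k T) 0 := by
  have hm : Measurable fun x => G.kernelFun lam x * featureFun lam T p u x :=
    (G.measurable_kernelFun lam).mul (measurable_featureFun lam T hp hu)
  set L : (Fin G.nx → ℝ) →L[ℝ] ℝ := LinearMap.toContinuousLinearMap
    ((LinearMap.proj 0).comp (Matrix.mulVecLin (affineMatrix G.C (p T)))) with hL
  have hLx : ∀ x, L x = (affineMatrix G.C (p T) *ᵥ x) 0 := fun x => rfl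
  have h1 := L.hasSum (G.summable_stateTerm hp hu hp1 hU hu0 T).hasSum
  have h2 : HasSum (fun k => L (G.stateTerm p u k T))
      (∫ x, G.kernelFun lam x * featureFun lam T p u x ∂(kernelMeasure np nin)) := by
    -- Integrability on the whole kernel space permits grouping the countable family of integrals by
    -- the order `k`, which recovers the terms of the Volterra series.
    refine (hasSum_integral_sigmaMeasure hm hi).sigma fun k => ?_
    have e : L (G.stateTerm p u k T) = ∑ a : (Fin (np + 1) × Fin (np + 1)) ×
        (Fin k → Fin np) × Fin nin, ∫ τ in timeSimplex (k + 1),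
          G.kernelFun lam ⟨⟨k, a⟩, τ⟩ * featureFun lam T p u ⟨⟨k, a⟩, τ⟩ := by
      rw [stateTerm, ← L.integral_comp_comm (G.integrableOn_stateKernel hp hu hp1 hU hu0 k T),
        ← integral_finsetSum _ fun a _ => integrable_fiber_of_sigmaMeasure hm hi ⟨k, a⟩]
      refine integral_congr_ae (ae_of_all _ fun τ => ?_)
      simp only [hLx]
      rw [G.mulVec_stateKernel_eq_sum lam, Fintype.sum_prod_type, Fintype.sum_prod_type]
      refine Finset.sum_congr rfl fun iq _ => Finset.sum_congr rfl fun ir _ => ?_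
      rw [Fintype.sum_prod_type]
    rw [e]
    exact hasSum_fintype _
  rw [← hLx]
  exact h2.unique h1

end LPVSystem

namespace LPVSystem

variable {np nin : ℕ}

lemma memLp_kernelFun (G : LPVSystem np nin) {lam : ℝ} {cE : ℝ≥0}
    (h : G.h2Norm lam ≤ (cE : ℝ≥0∞)) : MemLp (G.kernelFun lam) 2 (kernelMeasure np nin) :=
  ⟨(G.measurable_kernelFun lam).aestronglyMeasurable,
    (G.eLpNorm_kernelFun lam).trans_lt (h.trans_lt ENNReal.coe_lt_top)⟩

lemma eLpNorm_featureFun_le {lam T Lu : ℝ} (hT : 0 ≤ T) (hlam : (np : ℝ) ≤ lam)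
    {p : ℝ → Fin np → ℝ} (hp : Measurable p) (hp1 : ∀ t i, |p t i| ≤ 1)
    {u : ℝ → Fin nin → ℝ} (hu : PiecewiseContinuousOn u 0 T) (hLu : l2Norm T u ≤ Lu) :
    eLpNorm (featureFun lam T p ((Icc 0 T).indicator u)) 2 (kernelMeasure np nin) ≤
      ENNReal.ofReal (Lu * ((np : ℝ) + 1)) := by
  obtain ⟨U, hU⟩ := hu.exists_norm_indicator_le
  have hum := hu.measurable_indicator
  have hL0 : 0 ≤ Lu := (Real.sqrt_nonneg _).trans hLu
  set v := (Icc 0 T).indicator u with hv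
  have hvj : ∀ j, Measurable fun t => v t j := fun j => (measurable_pi_apply j).comp hum
  have h1 : ∫⁻ t, ENNReal.ofReal (∑ j, v t j ^ 2) ≤ ENNReal.ofReal (Lu ^ 2) := by
    have e1 : ∫⁻ t, ENNReal.ofReal (∑ j, v t j ^ 2) =
        ∫⁻ t in Icc 0 T, ENNReal.ofReal (∑ j, v t j ^ 2) := by
      rw [← lintegral_indicator measurableSet_Icc]
      refine lintegral_congr fun t => ?_
      by_cases ht : t ∈ Icc 0 T
      · rw [indicator_of_mem ht]
      · rw [indicator_of_notMem ht, hv, indicator_of_notMem ht]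
        simp
    have hi : IntegrableOn (fun t => ∑ j, v t j ^ 2) (Icc 0 T) := by
      refine Measure.integrableOn_of_bounded (M := ∑ _j : Fin nin, U ^ 2)
        isCompact_Icc.measure_lt_top.ne ?_ (ae_of_all _ fun t => ?_)
      · have : Measurable fun t => ∑ j, v t j ^ 2 := by fun_prop
        exact this.aestronglyMeasurable
      · refine (norm_sum_le _ _).trans (Finset.sum_le_sum fun j _ => ?_)
        rw [norm_pow]
        exact pow_le_pow_left₀ (norm_nonneg _) ((norm_le_pi_norm _ j).trans (hU t)) 2
    have h0 : ∀ t, 0 ≤ ∑ j, v t j ^ 2 := fun t => Finset.sum_nonneg fun j _ => sq_nonneg _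
    rw [e1, ← ofReal_integral_eq_lintegral_ofReal hi (ae_of_all _ h0)]
    refine ENNReal.ofReal_le_ofReal ?_
    have e2 : ∫ t in Icc 0 T, ∑ j, v t j ^ 2 = ∫ t in (0 : ℝ)..T, ∑ j, u t j ^ 2 := by
      rw [intervalIntegral.integral_of_le hT, ← integral_Icc_eq_integral_Ioc]
      refine setIntegral_congr_fun measurableSet_Icc fun t ht => ?_
      simp only [hv, indicator_of_mem ht]
    rw [e2]
    exact (Real.sqrt_le_left hL0).1 hLu
  rw [eLpNorm_two_eq_lintegral_sq]
  have h2 := (lintegral_featureFun_sq_le (T := T) hlam hp hp1 hum).trans (mul_le_mul_right h1 _)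
  refine (ENNReal.rpow_le_rpow h2 (by norm_num)).trans_eq ?_
  have e3 : ((np : ℝ≥0∞) + 1) ^ 2 * ENNReal.ofReal (Lu ^ 2) =
      ENNReal.ofReal ((Lu * ((np : ℝ) + 1)) ^ 2) := by
    rw [mul_pow, mul_comm, ENNReal.ofReal_mul (by positivity),
      ENNReal.ofReal_pow (p := (np : ℝ) + 1) (by positivity), ENNReal.ofReal_add (by positivity) zero_le_one, ENNReal.ofReal_natCast,
      ENNReal.ofReal_one]
  rw [e3, ENNReal.ofReal_rpow_of_nonneg (by positivity) (by norm_num), ← Real.sqrt_eq_rpow,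
    Real.sqrt_sq (by positivity)]

/-- The output at the final time is an inner product of a vector that depends only on the system
and one that depends only on the signals. -/
lemma output_eq_inner (G : LPVSystem np nin) {lam T : ℝ} (hT : 0 ≤ T)
    {p : ℝ → Fin np → ℝ} {u : ℝ → Fin nin → ℝ} (hp : PiecewiseContinuousOn p 0 T)
    (hp1 : ∀ t ∈ Icc 0 T, ∀ i, p t i ∈ Icc (-1 : ℝ) 1) (hu : PiecewiseContinuousOn u 0 T)
    (hw : MemLp (G.kernelFun lam) 2 (kernelMeasure np nin))
    (hφ : MemLp (featureFun lam T ((Icc 0 T).indicator p) ((Icc 0 T).indicator u)) 2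
      (kernelMeasure np nin)) :
    G.output T u p T = inner ℝ (hw.toLp _) (hφ.toLp _) := by
  obtain ⟨U, hU⟩ := hu.exists_norm_indicator_le
  have hp1' : ∀ t i, |(Icc 0 T).indicator p t i| ≤ 1 := fun t i => by
    by_cases h : t ∈ Icc 0 T
    · rw [indicator_of_mem h]; exact abs_le.2 (hp1 t h i)
    · rw [indicator_of_notMem h]; simp
  have hu0 : ∀ t < 0, (Icc 0 T).indicator u t = 0 := fun t ht =>
    indicator_of_notMem (fun h => absurd h.1 (not_le.2 ht)) _
  have hpT : (Icc 0 T).indicator p T = p T := indicator_of_mem (show T ∈ Icc 0 T from ⟨hT, le_rfl⟩) _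
  have key := G.integral_kernelFun_mul_featureFun (T := T) hp.measurable_indicator
    hu.measurable_indicator hp1' hU hu0 (hw.integrable_mul hφ)
  rw [hpT] at key
  rw [G.output_eq_tsum hT hp hp1 hu, ← key, L2.inner_def]
  refine integral_congr_ae ?_
  filter_upwards [hw.coeFn_toLp, hφ.coeFn_toLp] with x h1 h2
  rw [h1, h2]
  simp [mul_comm]

end LPVSystem

/-! ### The generalization bound -/

theorem theorem1
    -- dimensions, time horizon, range of the scheduling variables
    (np nin : ℕ) (hnp : 0 < np) (hnin : 0 < nin)
    (T : ℝ) (hT : 0 < T)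
    (ℙ : Set (Fin np → ℝ)) (hℙ : ∀ q ∈ ℙ, ∀ i, q i ∈ Set.Icc (-1 : ℝ) 1)
    -- signal sets
    (𝒰 : Set (ℝ → Fin nin → ℝ)) (𝒮 : Set (ℝ → Fin np → ℝ)) (𝒴 : Set (ℝ → ℝ))
    (h𝒰 : ∀ u ∈ 𝒰, PiecewiseContinuousOn u 0 T)
    (h𝒮 : ∀ p ∈ 𝒮, PiecewiseContinuousOn p 0 T ∧ ∀ t ∈ Set.Icc 0 T, p t ∈ ℙ)
    (h𝒴 : ∀ y ∈ 𝒴, PiecewiseContinuousOn y 0 T)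
    -- the family of systems and the loss
    (E : Set (LPVSystem np nin))
    (loss : ℝ → ℝ → ℝ) (hloss_nonneg : ∀ a b, 0 ≤ loss a b)
    -- the probability space of the data, with a suitable σ-algebra
    [MeasurableSpace (DataPoint 𝒰 𝒮 𝒴)] (D : Measure (DataPoint 𝒰 𝒮 𝒴)) [IsProbabilityMeasure D]
    (hmeas : ∀ G ∈ E, Measurable (fun z : DataPoint 𝒰 𝒮 𝒴 => pointLoss loss T G z))
    -- stability
    (lam : ℝ) (hlam : (np : ℝ) ≤ lam) (hstab : ∀ G ∈ E, G.IsQuadraticallyStable lam)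
    -- bounded H_2 norm
    (cE : ℝ≥0) (hH2 : ∀ G ∈ E, G.h2Norm lam ≤ (cE : ℝ≥0∞))
    -- bounded signals
    (Lu cy : ℝ) (hLu : ∀ u ∈ 𝒰, l2Norm T u ≤ Lu) (hcy : ∀ y ∈ 𝒴, |y T| ≤ cy)
    -- Lipschitz loss
    (Kl : ℝ)
    (hLip : ∀ y₁ y₁' y₂ y₂' : ℝ, |loss y₁ y₁' - loss y₂ y₂'| ≤ Kl * (|y₁ - y₂| + |y₁' - y₂'|))
    (hdiag : ∀ y : ℝ, loss y y = 0)
    -- sample size and confidence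
    (N : ℕ) (hN : 0 < N) (δ : ℝ) (hδ : δ ∈ Set.Ioo (0 : ℝ) 1) :
    (∀ G ∈ E, Integrable (fun z : DataPoint 𝒰 𝒮 𝒴 => pointLoss loss T G z) D) ∧
    MeasurableSet
      (uniformGapEvent D loss T E N (boundR (boundConst np Kl Lu cE cy) δ / √(N : ℝ))) ∧
    1 - δ ≤ (Measure.pi (fun _ : Fin N => D)).real
      (uniformGapEvent D loss T E N (boundR (boundConst np Kl Lu cE cy) δ / √(N : ℝ))) := by
  have hunit : ∀ z : DataPoint 𝒰 𝒮 𝒴, ∀ t ∈ Set.Icc 0 T, ∀ i,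
      (z.p : ℝ → Fin np → ℝ) t i ∈ Set.Icc (-1 : ℝ) 1 := fun z t ht i =>
    hℙ _ ((h𝒮 _ z.p.2).2 t ht) i
  have hunit' : ∀ z : DataPoint 𝒰 𝒮 𝒴, ∀ t i,
      |(Set.Icc 0 T).indicator (z.p : ℝ → Fin np → ℝ) t i| ≤ 1 := fun z t i => by
    by_cases h : t ∈ Set.Icc 0 T
    · rw [Set.indicator_of_mem h]; exact abs_le.2 (hunit z t h i)
    · rw [Set.indicator_of_notMem h]; simp
  have hpm : ∀ z : DataPoint 𝒰 𝒮 𝒴,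
      Measurable ((Set.Icc 0 T).indicator (z.p : ℝ → Fin np → ℝ)) := fun z =>
    (h𝒮 _ z.p.2).1.measurable_indicator
  have hnorm : ∀ z : DataPoint 𝒰 𝒮 𝒴, eLpNorm (LPVSystem.featureFun lam T
      ((Set.Icc 0 T).indicator (z.p : ℝ → Fin np → ℝ))
      ((Set.Icc 0 T).indicator (z.u : ℝ → Fin nin → ℝ))) 2 (LPVSystem.kernelMeasure np nin) ≤
        ENNReal.ofReal (Lu * ((np : ℝ) + 1)) := fun z =>
    LPVSystem.eLpNorm_featureFun_le hT.le hlam (hpm z) (hunit' z) (h𝒰 _ z.u.2) (hLu _ z.u.2)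
  have hφ : ∀ z : DataPoint 𝒰 𝒮 𝒴, MemLp (LPVSystem.featureFun lam T
      ((Set.Icc 0 T).indicator (z.p : ℝ → Fin np → ℝ))
      ((Set.Icc 0 T).indicator (z.u : ℝ → Fin nin → ℝ))) 2 (LPVSystem.kernelMeasure np nin) :=
    fun z => ⟨(LPVSystem.measurable_featureFun lam T (hpm z)
      (h𝒰 _ z.u.2).measurable_indicator).aestronglyMeasurable,
      (hnorm z).trans_lt ENNReal.ofReal_lt_top⟩
  have hw : ∀ G : E, MemLp (G.1.kernelFun lam) 2 (LPVSystem.kernelMeasure np nin) :=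
    fun G => G.1.memLp_kernelFun (hH2 G.1 G.2)
  have hout : ∀ (G : E) (z : DataPoint 𝒰 𝒮 𝒴), G.1.output T z.u z.p T =
      inner ℝ ((hw G).toLp _) ((hφ z).toLp _) := fun G z =>
    G.1.output_eq_inner hT.le (h𝒮 _ z.p.2).1 (hunit z) (h𝒰 _ z.u.2) (hw G) (hφ z)
  obtain ⟨z₀⟩ := nonempty_of_isProbabilityMeasure D
  have hLu0 : 0 ≤ Lu := (Real.sqrt_nonneg _).trans (hLu _ z₀.u.2)
  -- Finiteness of the exponent enters the separability of L², which the reduction to a countable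
  -- subfamily uses.
  have : Fact ((2 : ℝ≥0∞) ≠ ∞) := ⟨ENNReal.ofNat_ne_top⟩
  -- The radii `cE` for the kernels and `Lu * (np + 1)` for the features make the constant of the
  -- abstract bound literally `boundConst`. Measurability is needed only for the losses, not for the
  -- feature map.
  have key := uniform_deviation_linear_class D (w := fun G : E => (hw G).toLp _)
    (φ := fun z => (hφ z).toLp _) (y := fun z => (z.y : ℝ → ℝ) T) (loss := loss) (e := cE)
    (r := Lu * ((np : ℝ) + 1)) (cy := cy) (K := Kl)
    (fun G => by simpa only [pointLoss, hout G] using hmeas G.1 G.2) cE.2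
    (fun G => by
      rw [Lp.norm_toLp, G.1.eLpNorm_kernelFun]
      exact ENNReal.toReal_le_coe_of_le_coe (hH2 G.1 G.2))
    (fun z => by
      rw [Lp.norm_toLp]
      exact ENNReal.toReal_le_of_le_ofReal (by positivity) (hnorm z))
    (fun z => hcy _ z.y.2) hLip hdiag hN hδ (c := boundConst np Kl Lu cE cy) rfl
    (A := uniformGapEvent D loss T E N (boundR (boundConst np Kl Lu cE cy) δ / √(N : ℝ))) (by
      ext S
      simp only [uniformGapEvent, trueRisk, empiricalRisk, pointLoss, boundR, Set.mem_ofPred_eq,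
        ← hout, Subtype.forall])
  refine ⟨fun G hG => ?_, key.2⟩
  have e : (fun z : DataPoint 𝒰 𝒮 𝒴 => pointLoss loss T G z) = fun z =>
      loss (inner ℝ ((hw ⟨G, hG⟩).toLp _) ((hφ z).toLp _)) ((z.y : ℝ → ℝ) T) :=
    funext fun z => congrArg (loss · _) (hout ⟨G, hG⟩ z)
  rw [e]
  exact key.1 ⟨G, hG⟩
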